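/- Let $V$ be a countable set and let $L=(L(x,y))_{x,y\in V}$ be a real matrix with $L(x,y)\ge 0$ for $x\ne y$ and $L(x,x)=-\sum_{y\ne x}L(x,y)$ (a convergent sum). Put $L(x)=-L(x,x)\in[0,\infty)$, and for $f:V\to[0,\infty]$ put $\mathcal K[f](x)=\sum_{y\neq x}L(x,y)f(y)\in[0,\infty]$, where $0\cdot\infty=0$. Let $X=(X_t)_{t\ge0}$ be the associated jump process, started from $x$ under $\mathbb P_x$: in a state $y$ it waits an exponential time of parameter $L(y)$ (forever if $L(y)=0$) and then jumps to $z\ne y$ with probability $L(y,z)/L(y)$, all draws being independent except for these dependences. Let $0=\sigma_0\le\sigma_1\le\cdots$ be its jump times in $[0,\infty]$, with $\sigma_n=\infty$ if fewer than $n$ jumps occur. Explosion, that is $\lim_n\sigma_n<\infty$, is allowed, and $X_t=\triangle$ for $t\ge\lim_n\sigma_n$, where $\triangle\notin V$ is a cemetery point. Functions on $V$ are extended by $0$ at $\triangle$, and $e^{-r\tau}f(X_\tau)$ is understood to be $0$ on $\{\tau=\infty\}$. Let $r>0$ and $\phi:V\to[0,\infty]$. Let $$u(x)=\sup_\tau\mathbb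 E_x\big[e^{-r\tau}\phi(X_\tau)\big],\qquad D=\{x\in V:\ u(x)=\phi(x)\},$$ where $\tau$ runs over all $[0,\infty]$-valued stopping times of the ($\mathbb P_x$-)completed right-continuous filtration generated by $X$. Define $D_0=V$, $u_0=\phi$ and, recursively for $n\ge0$, $$D_{n+1}=\{x\in D_n:\ \mathcal K[u_n](x)\le(r+L(x))u_n(x)\},\qquad \tau_{n+1}=\inf\{t\ge0:\ X_t\in D_{n+1}\}\quad(\inf\emptyset=\infty),$$ $$u_{n+1}^{(m)}(x)=\mathbb E_x\Big[e^{-r(\sigma_m\wedge\tau_{n+1})}\,u_n\big(X_{\sigma_m\wedge\tau_{n+1}}\big)\Big]\quad(m\ge0),\qquad u_{n+1}(x)=\lim_{m\to\infty}u_{n+1}^{(m)}(x).$$ Then the following hold. 1. The sets $D_n$ are nonincreasing in $n$. 2. For every $n$ the functions $u_{n+1}^{(m)}$ are nondecreasing in $m$, so that the limit defining $u_{n+1}$ exists in $[0,\infty]$ and the recursion makes sense. 3. For every $n$ one has $u_n=\phi$ on $D_n$ and $(r+L(x))u_n(x)=\mathcal K[u_n](x)$ for every $x\in V\setminus D_n$.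 4. The functions $u_n$ are nondecreasing in $n$, and $u_\infty:=\lim_n u_n$ and $D_\infty:=\bigcap_n D_n$ satisfy $$u_\infty=u\qquad\text{and}\qquad D_\infty=D.$$ No uniform integrability assumption is made on $\phi$. -/

import Mathlib

open MeasureTheory ProbabilityTheory Filter Topology
open scoped NNReal ENNReal

noncomputable section

/-- A Markov generator on `V`: an infinite matrix of real numbers with nonnegative off-diagonal
entries, whose diagonal entries satisfy `L x x = - ∑_{y ≠ x} L x y` (a convergent sum). -/
structure MarkovGenerator (V : Type*) where
  rate : V → V → ℝ
  rate_nonneg : ∀ x y, x ≠ y → 0 ≤ rate x y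
  hasSum_rate : ∀ x, HasSum (fun y : {y : V // y ≠ x} => rate x y) (-rate x x)

namespace MarkovGenerator

/-- The total jump rate `L(x) = -L(x,x)`. -/
def exitRate {V : Type*} (L : MarkovGenerator V) (x : V) : ℝ := -L.rate x x

theorem exitRate_nonneg {V : Type*} (L : MarkovGenerator V) (x : V) : 0 ≤ L.exitRate x :=
  (L.hasSum_rate x).nonneg fun (y : {y : V // y ≠ x}) => L.rate_nonneg x y y.2.symm

/-- The action of the off-diagonal part of the generator on `[0,∞]`-valued functions,
`K[f](x) = ∑_{y ≠ x} L(x,y) f(y)`, with the convention `0 * ∞ = 0`. -/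
def offDiag {V : Type*} (L : MarkovGenerator V) (f : V → ℝ≥0∞) (x : V) : ℝ≥0∞ :=
  ∑' y : {y : V // y ≠ x}, ENNReal.ofReal (L.rate x y) * f y

/-! ### The jump-and-hold construction of the Markov process -/

/-- The law of the state reached by a jump from `x`: `L(x,·)/L(x)` on `V \ {x}` if `L(x) > 0`.
If `L(x) = 0` there is no jump, and the (irrelevant) next state is `x` itself. -/
def jumpLaw {V : Type*} [MeasurableSpace V] (L : MarkovGenerator V) (x : V) : Measure V :=
  open Classical in
  if L.exitRate x = 0 then Measure.dirac x
  else Measure.sum fun y : {y : V // y ≠ x} =>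
    ENNReal.ofReal (L.rate x y / L.exitRate x) • Measure.dirac (y : V)

/-- The law of the holding time at `x`: exponential with parameter `L(x)` if `L(x) > 0`,
and `+∞` if `L(x) = 0`. -/
def holdLaw {V : Type*} (L : MarkovGenerator V) (x : V) : Measure ℝ≥0∞ :=
  open Classical in
  if L.exitRate x = 0 then Measure.dirac ∞
  else (expMeasure (L.exitRate x)).map ENNReal.ofReal

instance isProbabilityMeasure_jumpLaw {V : Type*} [MeasurableSpace V] (L : MarkovGenerator V)
    (x : V) : IsProbabilityMeasure (L.jumpLaw x) := by
  unfold jumpLaw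
  split_ifs with h
  · infer_instance
  · constructor
    have hpos : 0 < L.exitRate x := lt_of_le_of_ne (L.exitRate_nonneg x) (Ne.symm h)
    have hs : HasSum (fun y : {y : V // y ≠ x} => L.rate x y / L.exitRate x) 1 := by
      have := (L.hasSum_rate x).div_const (L.exitRate x)
      rwa [show -L.rate x x / L.exitRate x = 1 from div_self h] at this
    rw [Measure.sum_apply _ MeasurableSet.univ]
    simp only [Measure.smul_apply, measure_univ, smul_eq_mul, mul_one]
    rw [← ENNReal.ofReal_tsum_of_nonneg _ hs.summable, hs.tsum_eq, ENNReal.ofReal_one]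
    intro y
    exact div_nonneg (L.rate_nonneg x y y.2.symm) hpos.le

instance isProbabilityMeasure_holdLaw {V : Type*} (L : MarkovGenerator V) (x : V) :
    IsProbabilityMeasure (L.holdLaw x) := by
  unfold holdLaw
  split_ifs with h
  · infer_instance
  · have hpos : 0 < L.exitRate x := lt_of_le_of_ne (L.exitRate_nonneg x) (Ne.symm h)
    have := isProbabilityMeasure_expMeasure hpos
    exact Measure.isProbabilityMeasure_map ENNReal.measurable_ofReal.aemeasurable

/-- The sample space: a sequence of (visited state, holding time in that state). -/
abbrev Path (V : Type*) : Type _ := ℕ → V × ℝ≥0∞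

section Kernels

variable {V : Type*} [Countable V] [MeasurableSpace V] [DiscreteMeasurableSpace V]

/-- Jump laws as a kernel. -/
def jumpKernel (L : MarkovGenerator V) : Kernel V V := Kernel.ofFunOfCountable L.jumpLaw

/-- Holding time laws as a kernel. -/
def holdKernel (L : MarkovGenerator V) : Kernel V ℝ≥0∞ := Kernel.ofFunOfCountable L.holdLaw

instance isMarkovKernel_jumpKernel (L : MarkovGenerator V) : IsMarkovKernel L.jumpKernel :=
  ⟨fun x => isProbabilityMeasure_jumpLaw L x⟩

instance isMarkovKernel_holdKernel (L : MarkovGenerator V) : IsMarkovKernel L.holdKernel :=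
  ⟨fun x => isProbabilityMeasure_holdLaw L x⟩

/-- One step: from the current state `y`, draw the next state from the jump law at `y`, then the
holding time in this next state. -/
def stepKernel (L : MarkovGenerator V) : Kernel V (V × ℝ≥0∞) :=
  L.jumpKernel ⊗ₖ Kernel.prodMkLeft V L.holdKernel

instance isMarkovKernel_stepKernel (L : MarkovGenerator V) : IsMarkovKernel L.stepKernel := by
  unfold stepKernel; infer_instance

/-- The step kernel, seen as a kernel from the whole past up to step `n`. -/
def pastKernel (L : MarkovGenerator V) (n : ℕ) :
    Kernel ((i : Finset.Iic n) → (fun _ : ℕ => V × ℝ≥0∞) i) ((fun _ : ℕ => V × ℝ≥0∞) (n + 1)) :=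
  L.stepKernel.comap (fun p => (p ⟨n, Finset.mem_Iic.2 le_rfl⟩).1) (by fun_prop)

instance isMarkovKernel_pastKernel (L : MarkovGenerator V) (n : ℕ) :
    IsMarkovKernel (L.pastKernel n) := by
  unfold pastKernel; infer_instance

/-- The probability measure `P_m` on the sample space, for the initial distribution `m`. -/
def pathMeasure (L : MarkovGenerator V) (m : Measure V) [IsProbabilityMeasure m] :
    Measure (Path V) :=
  Kernel.trajMeasure (X := fun _ : ℕ => V × ℝ≥0∞) (m ⊗ₘ L.holdKernel) L.pastKernel

/-- The probability measure `P_x` (start from `x`). -/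
def startAt (L : MarkovGenerator V) (x : V) : Measure (Path V) := L.pathMeasure (Measure.dirac x)

end Kernels

/-! ### The process, its filtration and its stopping times -/

/-- The jump times: `σ_0 = 0` and `σ_n` is the sum of the first `n` holding times. -/
def jumpTime {V : Type*} (n : ℕ) (ω : Path V) : ℝ≥0∞ := ∑ k ∈ Finset.range n, (ω k).2

/-- The process `X_t`, with values in `V ⊔ {△}`, the cemetery point being `OnePoint.infty`:
`X_t` is the `n`-th visited state for `σ_n ≤ t < σ_{n+1}`, and `X_t = △` from the explosion time
`lim σ_n` on. -/
def process {V : Type*} (t : ℝ≥0) (ω : Path V) : OnePoint V :=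
  open Classical in
  if h : ∃ n, (t : ℝ≥0∞) < jumpTime (n + 1) ω then ((ω (Nat.find h)).1 : OnePoint V)
  else OnePoint.infty

theorem measurable_jumpTime {V : Type*} [MeasurableSpace V] (n : ℕ) :
    Measurable (jumpTime (V := V) n) := by
  unfold jumpTime
  fun_prop

theorem measurable_process {V : Type*} [Countable V] [MeasurableSpace V]
    [DiscreteMeasurableSpace V] (t : ℝ≥0) :
    @Measurable _ _ _ ⊤ (process (V := V) t) := by
  classical
  let _ : MeasurableSpace (OnePoint V) := ⊤
  have hE : MeasurableSet {ω : Path V | ∃ n, (t : ℝ≥0∞) < jumpTime (n + 1) ω} := by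
    simp only [Set.ofPred_exists]
    exact MeasurableSet.iUnion fun n =>
      measurableSet_lt measurable_const (measurable_jumpTime (n + 1))
  have hcoe : Measurable (fun v : V => (v : OnePoint V)) := measurable_of_countable _
  refine Measurable.dite (s := {ω : Path V | ∃ n, (t : ℝ≥0∞) < jumpTime (n + 1) ω})
    (f := fun ω => ((ω.1 (Nat.find ω.2)).1 : OnePoint V)) (g := fun _ => OnePoint.infty)
    ?_ measurable_const hE
  have key : Measurable fun ω : {ω : Path V | ∃ n, (t : ℝ≥0∞) < jumpTime (n + 1) ω} =>
      (ω.1 (Nat.find ω.2)).1 := by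
    refine Measurable.find 
      (f := fun n (ω : {ω : Path V | ∃ n, (t : ℝ≥0∞) < jumpTime (n + 1) ω}) => (ω.1 n).1)
      (p := fun n (ω : {ω : Path V | ∃ n, (t : ℝ≥0∞) < jumpTime (n + 1) ω}) =>
        (t : ℝ≥0∞) < jumpTime (n + 1) ω.1) (fun n => ?_) (fun n => ?_)
      (fun ω => ω.2)
    · exact measurable_fst.comp ((measurable_pi_apply n).comp measurable_subtype_coe)
    · exact measurableSet_lt measurable_const
        ((measurable_jumpTime (n + 1)).comp measurable_subtype_coe)
  exact hcoe.comp key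

section Stopping

variable {V : Type*} [Countable V] [MeasurableSpace V] [DiscreteMeasurableSpace V]

/-- The σ-algebra generated by `X_s`, `s ≤ t`. -/
abbrev pastSigma (V : Type*) (t : ℝ≥0) : MeasurableSpace (Path V) :=
  ⨆ s : Set.Iic t, (⊤ : MeasurableSpace (OnePoint V)).comap (process s.1)

/-- The `P_x`-completion of the filtration generated by `X`. -/
def completedFiltration (L : MarkovGenerator V) (x : V) :
    Filtration ℝ≥0 (eventuallyMeasurableSpace MeasurableSpace.pi
      (ae (L.startAt x))) where
  seq t := eventuallyMeasurableSpace (pastSigma V t) (ae (L.startAt x))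
  mono' := by
    rintro s t hst A ⟨B, hB, hAB⟩
    refine ⟨B, ?_, hAB⟩
    have : pastSigma V s ≤ pastSigma V t :=
      iSup_le fun i => le_iSup (fun j : Set.Iic t =>
        (⊤ : MeasurableSpace (OnePoint V)).comap (process (V := V) j.1))
        ⟨i.1, le_trans i.2 hst⟩
    exact this B hB
  le' := by
    rintro t A ⟨B, hB, hAB⟩
    refine ⟨B, ?_, hAB⟩
    have : pastSigma V t ≤ MeasurableSpace.pi :=
      iSup_le fun i => (measurable_process (V := V) i.1).comap_le
    exact this B hB

/-- The completed right-continuous filtration generated by `X` under `P_x`. -/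
def usualFiltration (L : MarkovGenerator V) (x : V) :
    Filtration ℝ≥0 (eventuallyMeasurableSpace MeasurableSpace.pi
      (ae (L.startAt x))) :=
  (L.completedFiltration x).rightCont

/-- The `[0,∞]`-valued stopping times of the completed right-continuous filtration. -/
def stoppingTimes (L : MarkovGenerator V) (x : V) : Set (Path V → ℝ≥0∞) :=
  {τ | IsStoppingTime (L.usualFiltration x) τ}

end Stopping

/-- `τ_D = inf {t ≥ 0 : X_t ∈ D}`, with `inf ∅ = +∞`. -/
def hitTime {V : Type*} (D : Set V) (ω : Path V) : ℝ≥0∞ :=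
  ⨅ (t : ℝ≥0) (_ : ∃ y ∈ D, process t ω = (y : OnePoint V)), (t : ℝ≥0∞)

/-- A payoff on `V`, extended by `0` at the cemetery point. -/
def extendZero {V : Type*} (f : V → ℝ≥0∞) (z : OnePoint V) : ℝ≥0∞ :=
  z.elim 0 f

/-- The discounted payoff `exp (-r T) f(X_T)` at the time `T ∈ [0,∞]`, equal to `0` if `T = ∞`. -/
def discountedPayoff {V : Type*} (r : ℝ) (f : V → ℝ≥0∞) (T : ℝ≥0∞) (ω : Path V) : ℝ≥0∞ :=
  open Classical in
  if T = ∞ then 0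
  else ENNReal.ofReal (Real.exp (-r * T.toReal)) * extendZero f (process T.toNNReal ω)

/-! ### The value function and the recursive construction -/

section Value

variable {V : Type*} [Countable V] [MeasurableSpace V] [DiscreteMeasurableSpace V]

/-- `E_x[exp (-r τ) f(X_τ)]`. -/
def stopValue (L : MarkovGenerator V) (r : ℝ) (f : V → ℝ≥0∞) (τ : Path V → ℝ≥0∞) (x : V) :
    ℝ≥0∞ :=
  ∫⁻ ω, discountedPayoff r f (τ ω) ω ∂(L.startAt x)

/-- The value function `u(x) = sup_τ E_x[exp (-r τ) φ(X_τ)]` of the optimal stopping problem. -/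
def value (L : MarkovGenerator V) (r : ℝ) (φ : V → ℝ≥0∞) (x : V) : ℝ≥0∞ :=
  ⨆ τ ∈ L.stoppingTimes x, L.stopValue r φ τ x

/-- The subset `{x ∈ D : K[v](x) ≤ (r + L(x)) v(x)}` of `D`. -/
def refineSet (L : MarkovGenerator V) (r : ℝ) (D : Set V) (v : V → ℝ≥0∞) : Set V :=
  {x ∈ D | L.offDiag v x ≤ ENNReal.ofReal (r + L.exitRate x) * v x}

/-- `E_x[exp (-r (σ_m ∧ τ_D)) v(X_{σ_m ∧ τ_D})]`. -/
def truncValue (L : MarkovGenerator V) (r : ℝ) (D : Set V) (v : V → ℝ≥0∞) (m : ℕ) (x : V) :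
    ℝ≥0∞ :=
  L.stopValue r v (fun ω => min (jumpTime m ω) (hitTime D ω)) x

/-- The pairs `(D_n, u_n)`: `D_0 = V`, `u_0 = φ`, then
`D_{n+1} = {x ∈ D_n : K[u_n](x) ≤ (r + L(x)) u_n(x)}` and
`u_{n+1}(x) = lim_m E_x[exp (-r (σ_m ∧ τ_{n+1})) u_n(X_{σ_m ∧ τ_{n+1}})]`, where `τ_{n+1}` is the
hitting time of `D_{n+1}`. This sequence is nondecreasing in `m`, and its limit is written as a
supremum. -/
def recursion (L : MarkovGenerator V) (r : ℝ) (φ : V → ℝ≥0∞) : ℕ → Set V × (V → ℝ≥0∞)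
  | 0 => (Set.univ, φ)
  | n + 1 =>
    let p := recursion L r φ n
    (L.refineSet r p.1 p.2, fun x => ⨆ m : ℕ, L.truncValue r (L.refineSet r p.1 p.2) p.2 m x)

/-- The set `D_n`. -/
def stopSet (L : MarkovGenerator V) (r : ℝ) (φ : V → ℝ≥0∞) (n : ℕ) : Set V :=
  (L.recursion r φ n).1

/-- The function `u_n`. -/
def approx (L : MarkovGenerator V) (r : ℝ) (φ : V → ℝ≥0∞) (n : ℕ) : V → ℝ≥0∞ :=
  (L.recursion r φ n).2

/-- The function `u_{n+1}^{(m)}(x) = E_x[exp (-r (σ_m ∧ τ_{n+1})) u_n(X_{σ_m ∧ τ_{n+1}})]`. -/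
def approxTrunc (L : MarkovGenerator V) (r : ℝ) (φ : V → ℝ≥0∞) (n m : ℕ) : V → ℝ≥0∞ :=
  L.truncValue r (L.stopSet r φ (n + 1)) (L.approx r φ n) m

end Value

end MarkovGenerator

end

/-!
The proof works with the operator `firstJump r f = K[f] / (r + L)`, which is the expected discounted
payoff at the first jump time. The main probabilistic tool is the Markov property at the first jump
(`lintegral_startAt`): under `P_x` the path consists of the holding time in `x` and, independently,
a path of the same process started from a state drawn from the jump law. It turns every expectation
below into an induction on the number of jumps.

*Recursion.* Let `Z_j` be the `j`-th visited state. On almost every path `σ_m ∧ τ_D` is the time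
`σ_j` of the first `j` with `j ≥ m` or `Z_j ∈ D`, so `m ↦ truncValue r D v m` iterates the monotone
map that equals `v` on `D` and applies `firstJump r` off `D`. As `v ≤ firstJump r v` off `D` for `v
= u_n` and `D = D_{n+1}`, the iterates increase and their limit is a fixed point. Hence `u_n = φ` on
`D_n`, and `u_n = firstJump r u_n` off `D_n`; monotone convergence shows that `u_∞` is excessive,
that is `firstJump r u_∞ ≤ u_∞`.

*`u_∞ ≤ u`.* All `u_n` lie below every excessive majorant of `φ`. One such majorant is the limit of
the values `horizonValue k` for stopping at one of `σ_0, …, σ_k`. Each of these is attained by a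
rule that looks only at the visited states, and such a rule is a stopping time
(`ruleTime_mem_stoppingTimes`), so its payoff is at most `u`.

*`u ≤ u_∞`.* Every stopping time is almost surely equal to a time `ρ` that, between two successive
jumps, is a function of the history at the first of them (`exists_nonanticipating_ae_eq`). Before
the first jump `ρ` is therefore a constant `c`, and waiting until `c` or the first jump does not
improve an excessive value, by an explicit computation with exponential laws (`lintegral_wait_le`).
Removing the first jump again and again gives `E_x[exp (-r ρ) w(X_ρ)] ≤ w(x)` for excessive `w`
(`value_le`). All integrands are nonnegative, so no integrability is needed.

The identity of the stopping regions follows, since `φ ≤ u_n ≤ u` and `u` is excessive.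
-/

noncomputable section

namespace MarkovGenerator

/-! ### Decomposition of the path at the first jump -/

section PathOperations

variable {V : Type*}

/-- The path that starts with `p` and continues with `ω`. -/
def consPath (p : V × ℝ≥0∞) (ω : Path V) : Path V
  | 0 => p
  | n + 1 => ω n

@[simp] lemma consPath_zero (p : V × ℝ≥0∞) (ω : Path V) : consPath p ω 0 = p := rfl

@[simp] lemma consPath_succ (p : V × ℝ≥0∞) (ω : Path V) (n : ℕ) :
    consPath p ω (n + 1) = ω n := rfl

/-- The path frozen at step `a`: all later steps repeat the step `a`. -/
def freeze (a : ℕ) (ω : Path V) : Path V := fun i => ω (min i a)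

lemma freeze_succ_consPath (a : ℕ) (p : V × ℝ≥0∞) (ω : Path V) :
    freeze (a + 1) (consPath p ω) = consPath p (freeze a ω) := by
  funext i
  cases i with
  | zero => simp [freeze]
  | succ i => simp [freeze, Nat.add_min_add_right]

lemma freeze_zero_consPath (p : V × ℝ≥0∞) (ω : Path V) :
    freeze 0 (consPath p ω) = fun _ => p := by
  funext i
  simp [freeze]

variable [MeasurableSpace V]

@[fun_prop]
lemma measurable_consPath : Measurable fun q : (V × ℝ≥0∞) × Path V => consPath q.1 q.2 := by
  refine measurable_pi_lambda _ fun n => ?_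
  cases n with
  | zero => exact measurable_fst
  | succ n => exact (measurable_pi_apply n).comp measurable_snd

@[fun_prop]
lemma measurable_freeze (a : ℕ) : Measurable (freeze (V := V) a) :=
  measurable_pi_lambda _ fun _ => measurable_pi_apply _

end PathOperations

section FirstStep

variable {V : Type*} [Countable V] [MeasurableSpace V] [DiscreteMeasurableSpace V]

/-- The one-step transitions of `μ` are those of the jump-and-hold chain. -/
def HasChainSteps (L : MarkovGenerator V) (μ : Measure (Path V)) : Prop :=
  ∀ (a : ℕ) (G : Path V × (V × ℝ≥0∞) → ℝ≥0∞), Measurable G →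
    ∫⁻ ω, G (freeze a ω, ω (a + 1)) ∂μ =
      ∫⁻ ω, ∫⁻ y, G (freeze a ω, y) ∂(L.stepKernel (ω a).1) ∂μ

instance (L : MarkovGenerator V) (x : V) : IsProbabilityMeasure (L.startAt x) := by
  unfold startAt pathMeasure
  infer_instance

lemma hasChainSteps_startAt (L : MarkovGenerator V) (x : V) :
    L.HasChainSteps (L.startAt x) := by
  intro a G hG
  let e : ((i : Finset.Iic a) → V × ℝ≥0∞) → Path V :=
    fun h i => h ⟨min i a, Finset.mem_Iic.2 (min_le_right _ _)⟩
  have he : Measurable e := measurable_pi_lambda _ fun _ => measurable_pi_apply _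
  have key := Kernel.map_frestrictLe_trajMeasure_compProd_eq_map_trajMeasure
    (X := fun _ : ℕ => V × ℝ≥0∞) (κ := L.pastKernel)
    (μ₀ := Measure.dirac x ⊗ₘ L.holdKernel) (a := a)
  have hG' : Measurable fun q : ((i : Finset.Iic a) → V × ℝ≥0∞) × (V × ℝ≥0∞) =>
      G (e q.1, q.2) := by fun_prop
  have h := congrArg (fun m => ∫⁻ q, G (e q.1, q.2) ∂m) key
  rw [Measure.lintegral_compProd hG', lintegral_map hG' (by fun_prop),
    lintegral_map (Measurable.lintegral_kernel_prod_right' hG') (by fun_prop)] at h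
  exact h.symm

lemma lintegral_eval_zero_startAt (L : MarkovGenerator V) (x : V) (f : V × ℝ≥0∞ → ℝ≥0∞)
    (hf : Measurable f) :
    ∫⁻ ω, f (ω 0) ∂(L.startAt x) = ∫⁻ s, f (x, s) ∂(L.holdLaw x) := by
  have h0 : Measurable fun ω : Path V => f (ω 0) := by fun_prop
  unfold startAt pathMeasure Kernel.trajMeasure
  rw [Measure.lintegral_bind (by fun_prop) h0.aemeasurable,
    lintegral_map (by fun_prop) (by fun_prop)]
  have : ∀ p : V × ℝ≥0∞, ∫⁻ ω, f (ω 0) ∂(Kernel.traj (X := fun _ : ℕ => V × ℝ≥0∞) L.pastKernel 0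
      ((MeasurableEquiv.piUnique fun _ : Finset.Iic 0 => V × ℝ≥0∞).symm p)) = f p := by
    intro p
    rw [Kernel.lintegral_traj _ h0]
    simp [Function.updateFinset]
  refine (lintegral_congr this).trans ?_
  rw [Measure.lintegral_compProd hf, lintegral_dirac]
  rfl

/-- A probability measure on the path space is determined by the law of the first step and by its
one-step transitions. -/
lemma HasChainSteps.ext {L : MarkovGenerator V} {μ ν : Measure (Path V)}
    [IsProbabilityMeasure μ] [IsProbabilityMeasure ν]
    (hμ : L.HasChainSteps μ) (hν : L.HasChainSteps ν)
    (h0 : ∀ f : V × ℝ≥0∞ → ℝ≥0∞, Measurable f → ∫⁻ ω, f (ω 0) ∂μ = ∫⁻ ω, f (ω 0) ∂ν) :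
    μ = ν := by
  have hfreeze : ∀ (a : ℕ) (g : Path V → ℝ≥0∞), Measurable g →
      ∫⁻ ω, g (freeze a ω) ∂μ = ∫⁻ ω, g (freeze a ω) ∂ν := by
    intro a
    induction a with
    | zero =>
      intro g hg
      have := h0 (fun p => g fun _ => p)
        (hg.comp (measurable_pi_lambda _ fun _ => measurable_id))
      have hf : ∀ ω : Path V, freeze 0 ω = fun _ => ω 0 := fun ω => by
        funext i
        simp [freeze]
      simpa only [hf] using this
    | succ a ih =>
      intro g hg
      let J : Path V × (V × ℝ≥0∞) → Path V := fun q i => if i ≤ a then q.1 i else q.2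
      have hJ : Measurable J := by
        refine measurable_pi_lambda _ fun i => ?_
        by_cases hi : i ≤ a
        · simp only [J, hi, if_true]
          fun_prop
        · simp only [J, hi, if_false]
          fun_prop
      have hJf : ∀ ω : Path V, freeze (a + 1) ω = J (freeze a ω, ω (a + 1)) := by
        intro ω
        funext i
        by_cases hi : i ≤ a
        · simp [J, freeze, hi, Nat.le_succ_of_le hi]
        · have : min i (a + 1) = a + 1 := by omega
          simp [J, freeze, hi, this]
      simp only [hJf]
      rw [hμ a (fun q => g (J q)) (hg.comp hJ), hν a (fun q => g (J q)) (hg.comp hJ)]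
      have hstep : Measurable fun ω : Path V =>
          ∫⁻ y, g (J (ω, y)) ∂(L.stepKernel (ω a).1) := by
        exact Measurable.lintegral_kernel_prod_right'
          (κ := L.stepKernel.comap (fun ω : Path V => (ω a).1) (by fun_prop))
          (f := fun q => g (J q)) (hg.comp hJ)
      have := ih _ hstep
      simpa [freeze] using this
  refine MeasureTheory.ext_of_generate_finite (measurableCylinders fun _ : ℕ => V × ℝ≥0∞)
    generateFrom_measurableCylinders.symm isPiSystem_measurableCylinders ?_ (by simp)
  intro t ht
  have ht' := MeasurableSet.of_mem_measurableCylinders ht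
  rw [measurableCylinders_nat] at ht
  simp only [Set.mem_iUnion] at ht
  obtain ⟨N, S, -, rfl⟩ := ht
  have hind : ∀ ω : Path V, (cylinder (Finset.Iic N) S).indicator (1 : Path V → ℝ≥0∞) ω =
      (cylinder (Finset.Iic N) S).indicator 1 (freeze N ω) := by
    intro ω
    have : (Finset.Iic N).restrict (freeze N ω) = (Finset.Iic N).restrict ω := by
      funext i
      have := Finset.mem_Iic.1 i.2
      simp [freeze, this]
    have hmem : (ω ∈ cylinder (Finset.Iic N) S) ↔ (freeze N ω ∈ cylinder (Finset.Iic N) S) := by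
      change ((Finset.Iic N).restrict ω ∈ S) ↔ ((Finset.Iic N).restrict (freeze N ω) ∈ S)
      rw [this]
    by_cases h : ω ∈ cylinder (Finset.Iic N) S
    · rw [Set.indicator_of_mem h, Set.indicator_of_mem (hmem.mp h)]
      rfl
    · rw [Set.indicator_of_notMem h, Set.indicator_of_notMem (mt hmem.mpr h)]
  rw [← lintegral_indicator_one ht', ← lintegral_indicator_one ht', lintegral_congr hind,
    lintegral_congr hind]
  exact hfreeze N _ (measurable_one.indicator ht')

/-- The laws `P_x` as a kernel. -/
def startKernel (L : MarkovGenerator V) : Kernel V (Path V) := Kernel.ofFunOfCountable L.startAt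

instance (L : MarkovGenerator V) : IsMarkovKernel L.startKernel :=
  ⟨fun x => inferInstanceAs (IsProbabilityMeasure (L.startAt x))⟩

lemma lintegral_stepKernel (L : MarkovGenerator V) (x : V) {f : V × ℝ≥0∞ → ℝ≥0∞}
    (hf : Measurable f) :
    ∫⁻ y, f y ∂(L.stepKernel x) = ∫⁻ z, ∫⁻ s, f (z, s) ∂(L.holdLaw z) ∂(L.jumpLaw x) := by
  unfold stepKernel
  rw [Kernel.lintegral_compProd _ _ _ hf]
  rfl

/-- The Markov property at the first jump: under `P_x` the holding time in `x` and the path after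
the first jump are independent, and the latter is the path of the process started from a state
drawn from the jump law. -/
theorem lintegral_startAt (L : MarkovGenerator V) (x : V) {f : Path V → ℝ≥0∞}
    (hf : Measurable f) :
    ∫⁻ ω, f ω ∂(L.startAt x) =
      ∫⁻ s, ∫⁻ z, ∫⁻ ω, f (consPath (x, s) ω) ∂(L.startAt z) ∂(L.jumpLaw x) ∂(L.holdLaw x) := by
  let ρ : Measure (ℝ≥0∞ × Path V) := (L.holdLaw x).prod (L.startKernel ∘ₘ L.jumpLaw x)
  let ν : Measure (Path V) := ρ.map fun q => consPath (x, q.1) q.2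
  have hm : Measurable fun q : ℝ≥0∞ × Path V => consPath (x, q.1) q.2 := by fun_prop
  have hν : ∀ g : Path V → ℝ≥0∞, Measurable g → ∫⁻ ω, g ω ∂ν =
      ∫⁻ s, ∫⁻ z, ∫⁻ ω, g (consPath (x, s) ω) ∂(L.startAt z) ∂(L.jumpLaw x)
        ∂(L.holdLaw x) := by
    intro g hg
    rw [lintegral_map hg hm, lintegral_prod _ (by fun_prop)]
    refine lintegral_congr fun s => ?_
    rw [Measure.lintegral_bind (by fun_prop) (by fun_prop)]
    rfl
  have : IsProbabilityMeasure ν := Measure.isProbabilityMeasure_map hm.aemeasurable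
  suffices L.startAt x = ν by rw [this, hν f hf]
  refine (L.hasChainSteps_startAt x).ext ?_ ?_
  · intro a G hG
    rw [hν (fun ω => G (freeze a ω, ω (a + 1))) (by fun_prop)]
    have hR : Measurable fun ω : Path V =>
        ∫⁻ y, G (freeze a ω, y) ∂(L.stepKernel (ω a).1) :=
      Measurable.lintegral_kernel_prod_right'
        (κ := L.stepKernel.comap (fun ω : Path V => (ω a).1) (by fun_prop))
        (f := fun q => G (freeze a q.1, q.2)) (by fun_prop)
    rw [hν _ hR]
    refine lintegral_congr fun s => ?_
    cases a with
    | zero =>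
      simp only [freeze_zero_consPath, consPath_zero, consPath_succ, lintegral_const,
        measure_univ, mul_one]
      rw [lintegral_stepKernel L x (f := fun y => G (fun _ => (x, s), y)) (by fun_prop)]
      refine lintegral_congr fun z => ?_
      exact L.lintegral_eval_zero_startAt z (fun y => G (fun _ => (x, s), y)) (by fun_prop)
    | succ a =>
      refine lintegral_congr fun z => ?_
      simp only [freeze_succ_consPath, consPath_succ]
      exact L.hasChainSteps_startAt z a (fun q => G (consPath (x, s) q.1, q.2)) (by fun_prop)
  · intro g hg
    rw [hν (fun ω => g (ω 0)) (by fun_prop), lintegral_eval_zero_startAt L x g hg]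
    simp

end FirstStep

/-! ### Discounted payoffs along a path -/

/-- The discount factor `exp (-r t)` at `t ∈ [0,∞]`, equal to `0` at `t = ∞`. -/
def discount (r : ℝ) (t : ℝ≥0∞) : ℝ≥0∞ :=
  open Classical in if t = ∞ then 0 else ENNReal.ofReal (Real.exp (-r * t.toReal))

@[simp] lemma discount_top (r : ℝ) : discount r ∞ = 0 := by simp [discount]

@[simp] lemma discount_zero (r : ℝ) : discount r 0 = 1 := by simp [discount]

lemma discount_add (r : ℝ) (s t : ℝ≥0∞) : discount r (s + t) = discount r s * discount r t := by
  by_cases hs : s = ∞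
  · simp [hs]
  by_cases ht : t = ∞
  · simp [ht]
  simp only [discount, hs, ht, ENNReal.add_eq_top, or_self, if_false, ENNReal.toReal_add hs ht]
  rw [← ENNReal.ofReal_mul (Real.exp_pos _).le, ← Real.exp_add]
  ring_nf

@[fun_prop]
lemma measurable_discount (r : ℝ) : Measurable (discount r) := by
  unfold discount
  exact Measurable.ite (measurableSet_singleton _) measurable_const (by fun_prop)

section Paths

variable {V : Type*}

@[simp] lemma jumpTime_zero (ω : Path V) : jumpTime 0 ω = 0 := by simp [jumpTime]

lemma jumpTime_succ (n : ℕ) (ω : Path V) : jumpTime (n + 1) ω = jumpTime n ω + (ω n).2 := by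
  simp [jumpTime, Finset.sum_range_succ]

lemma jumpTime_succ_consPath (n : ℕ) (p : V × ℝ≥0∞) (ω : Path V) :
    jumpTime (n + 1) (consPath p ω) = p.2 + jumpTime n ω := by
  simp [jumpTime, Finset.sum_range_succ', add_comm]

lemma monotone_jumpTime (ω : Path V) : Monotone fun n => jumpTime n ω :=
  monotone_nat_of_le_succ fun n => by rw [jumpTime_succ]; exact le_self_add

lemma process_eq_of_mem {t : ℝ≥0} {ω : Path V} {n : ℕ} (h1 : jumpTime n ω ≤ t)
    (h2 : (t : ℝ≥0∞) < jumpTime (n + 1) ω) : process t ω = ((ω n).1 : OnePoint V) := by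
  classical
  have h : ∃ n, (t : ℝ≥0∞) < jumpTime (n + 1) ω := ⟨n, h2⟩
  have hn : Nat.find h = n := by
    rw [Nat.find_eq_iff]
    refine ⟨h2, fun m hm => not_lt.2 (le_trans (monotone_jumpTime ω hm) h1)⟩
  unfold process
  rw [dif_pos h]
  congr 3

lemma process_eq_infty {t : ℝ≥0} {ω : Path V} (h : ∀ n, jumpTime n ω ≤ t) :
    process t ω = OnePoint.infty := by
  unfold process
  rw [dif_neg]
  rintro ⟨n, hn⟩
  exact absurd (h (n + 1)) (not_le.2 hn)

/-- Every time lies in one of the intervals `[σ_n, σ_{n+1})` or after the explosion. -/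
lemma exists_mem_jumpInterval_or (T : ℝ≥0∞) (ω : Path V) :
    (∃ n, jumpTime n ω ≤ T ∧ T < jumpTime (n + 1) ω) ∨ ∀ n, jumpTime n ω ≤ T := by
  classical
  by_cases h : ∃ n, T < jumpTime n ω
  · left
    have hs := Nat.find_spec h
    obtain ⟨m, hm⟩ : ∃ m, Nat.find h = m + 1 := by
      refine Nat.exists_eq_succ_of_ne_zero fun h0 => ?_
      rw [h0] at hs
      simp at hs
    refine ⟨m, not_lt.1 (Nat.find_min h (by omega)), hm ▸ hs⟩
  · right
    simpa using h

lemma process_consPath_add {s t : ℝ≥0} {x : V} {ω : Path V} :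
    process (s + t) (consPath (x, (s : ℝ≥0∞)) ω) = process t ω := by
  rcases exists_mem_jumpInterval_or (t : ℝ≥0∞) ω with ⟨n, h1, h2⟩ | h
  · rw [process_eq_of_mem h1 h2, process_eq_of_mem (n := n + 1)]
    · rfl
    · rw [jumpTime_succ_consPath, ENNReal.coe_add]
      gcongr
    · rw [jumpTime_succ_consPath, ENNReal.coe_add]
      exact ENNReal.add_lt_add_left ENNReal.coe_ne_top h2
  · rw [process_eq_infty h, process_eq_infty]
    intro n
    refine (monotone_jumpTime _ n.le_succ).trans ?_
    simp only
    rw [jumpTime_succ_consPath, ENNReal.coe_add]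
    gcongr
    exact h n

lemma discountedPayoff_eq (r : ℝ) (f : V → ℝ≥0∞) (T : ℝ≥0∞) (ω : Path V) :
    discountedPayoff r f T ω = discount r T * extendZero f (process T.toNNReal ω) := by
  unfold discountedPayoff discount
  split_ifs <;> simp

lemma discountedPayoff_add_consPath (r : ℝ) (f : V → ℝ≥0∞) (p : V × ℝ≥0∞) (T : ℝ≥0∞)
    (ω : Path V) :
    discountedPayoff r f (p.2 + T) (consPath p ω) =
      discount r p.2 * discountedPayoff r f T ω := by
  obtain ⟨x, s⟩ := p
  rw [discountedPayoff_eq, discountedPayoff_eq, discount_add, mul_assoc]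
  induction s using ENNReal.recTopCoe with
  | top => simp
  | coe s =>
    induction T using ENNReal.recTopCoe with
    | top => simp
    | coe T => rw [← ENNReal.coe_add, ENNReal.toNNReal_coe, process_consPath_add,
        ENNReal.toNNReal_coe]

lemma discountedPayoff_of_mem (r : ℝ) (f : V → ℝ≥0∞) {T : ℝ≥0∞} {ω : Path V} {n : ℕ}
    (h1 : jumpTime n ω ≤ T) (h2 : T < jumpTime (n + 1) ω) :
    discountedPayoff r f T ω = discount r T * f (ω n).1 := by
  lift T to ℝ≥0 using h2.ne_top
  rw [discountedPayoff_eq, ENNReal.toNNReal_coe, process_eq_of_mem h1 h2]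
  rfl

/-- The discounted payoff at the time `T`, restricted to the event `σ_n ≤ T < σ_{n+1}` that exactly
`n` jumps occur up to time `T`. -/
def intervalPayoff (r : ℝ) (f : V → ℝ≥0∞) (n : ℕ) (T : ℝ≥0∞) (ω : Path V) : ℝ≥0∞ :=
  open Classical in
  if jumpTime n ω ≤ T ∧ T < jumpTime (n + 1) ω then discount r T * f (ω n).1 else 0

lemma intervalPayoff_of_mem (r : ℝ) (f : V → ℝ≥0∞) {T : ℝ≥0∞} {ω : Path V} {n : ℕ}
    (h1 : jumpTime n ω ≤ T) (h2 : T < jumpTime (n + 1) ω) :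
    intervalPayoff r f n T ω = discount r T * f (ω n).1 := if_pos ⟨h1, h2⟩

lemma intervalPayoff_of_lt (r : ℝ) (f : V → ℝ≥0∞) {T : ℝ≥0∞} {ω : Path V} {n : ℕ}
    (h : T < jumpTime n ω) : intervalPayoff r f n T ω = 0 :=
  if_neg fun h' => absurd h (not_lt.2 h'.1)

lemma intervalPayoff_of_le (r : ℝ) (f : V → ℝ≥0∞) {T : ℝ≥0∞} {ω : Path V} {n : ℕ}
    (h : jumpTime (n + 1) ω ≤ T) : intervalPayoff r f n T ω = 0 :=
  if_neg fun h' => absurd h (not_le.2 h'.2)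

lemma discountedPayoff_eq_tsum (r : ℝ) (f : V → ℝ≥0∞) (T : ℝ≥0∞) (ω : Path V) :
    discountedPayoff r f T ω = ∑' n, intervalPayoff r f n T ω := by
  rcases exists_mem_jumpInterval_or T ω with ⟨n, h1, h2⟩ | h
  · rw [tsum_eq_single n, intervalPayoff_of_mem r f h1 h2, discountedPayoff_of_mem r f h1 h2]
    intro m hm
    rcases lt_or_gt_of_ne hm with h | h
    · exact intervalPayoff_of_le r f ((monotone_jumpTime ω h).trans h1)
    · exact intervalPayoff_of_lt r f (h2.trans_le (monotone_jumpTime ω h))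
  · have h0 : discountedPayoff r f T ω = 0 := by
      rw [discountedPayoff_eq]
      induction T using ENNReal.recTopCoe with
      | top => simp
      | coe T =>
        rw [ENNReal.toNNReal_coe, process_eq_infty h]
        exact mul_zero _
    rw [h0, eq_comm, ENNReal.tsum_eq_zero]
    exact fun n => intervalPayoff_of_le r f (h (n + 1))

lemma intervalPayoff_mono (r : ℝ) {f g : V → ℝ≥0∞} (h : f ≤ g) (n : ℕ) (T : ℝ≥0∞) (ω : Path V) :
    intervalPayoff r f n T ω ≤ intervalPayoff r g n T ω := by
  unfold intervalPayoff
  split_ifs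
  · gcongr
    exact h _
  · exact le_rfl

lemma measurable_intervalPayoff [Countable V] [MeasurableSpace V] [DiscreteMeasurableSpace V]
    (r : ℝ) (f : V → ℝ≥0∞) (n : ℕ) {τ : Path V → ℝ≥0∞} (hτ : Measurable τ) :
    Measurable fun ω => intervalPayoff r f n (τ ω) ω := by
  have hf : Measurable f := measurable_of_countable f
  have hs : MeasurableSet {ω : Path V | jumpTime n ω ≤ τ ω ∧ τ ω < jumpTime (n + 1) ω} :=
    (measurableSet_le (measurable_jumpTime n) hτ).inter
      (measurableSet_lt hτ (measurable_jumpTime (n + 1)))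
  exact Measurable.ite hs (by fun_prop) measurable_const

lemma measurable_discountedPayoff [Countable V] [MeasurableSpace V] [DiscreteMeasurableSpace V]
    (r : ℝ) (f : V → ℝ≥0∞) {τ : Path V → ℝ≥0∞} (hτ : Measurable τ) :
    Measurable fun ω => discountedPayoff r f (τ ω) ω := by
  simp only [discountedPayoff_eq_tsum]
  exact Measurable.tsum fun n => measurable_intervalPayoff r f n hτ

/-! ### Stopping at a jump time -/

/-- The stopping rule "stop at the jump time `σ_j` of the first index `j` for which the `j`-th
visited state belongs to `A j`" (`∞` if there is none). -/
def ruleTime (A : ℕ → Set V) (ω : Path V) : ℝ≥0∞ :=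
  ⨅ (j : ℕ) (_ : (ω j).1 ∈ A j), jumpTime j ω

lemma measurable_ruleTime [Countable V] [MeasurableSpace V] [DiscreteMeasurableSpace V]
    (A : ℕ → Set V) : Measurable (ruleTime A) := by
  classical
  refine Measurable.iInf fun j => ?_
  have hs : MeasurableSet {ω : Path V | (ω j).1 ∈ A j} :=
    (by fun_prop : Measurable fun ω : Path V => (ω j).1) (MeasurableSet.of_discrete (s := A j))
  have : (fun ω : Path V => ⨅ (_ : (ω j).1 ∈ A j), jumpTime j ω) =
      fun ω => if ω ∈ {ω : Path V | (ω j).1 ∈ A j} then jumpTime j ω else ∞ := by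
    funext ω
    by_cases h : (ω j).1 ∈ A j <;> simp [h]
  rw [this]
  exact Measurable.ite hs (measurable_jumpTime j) measurable_const

lemma ruleTime_of_mem {A : ℕ → Set V} {ω : Path V} (h : (ω 0).1 ∈ A 0) : ruleTime A ω = 0 :=
  le_antisymm ((iInf₂_le 0 h).trans (by simp)) bot_le

lemma ruleTime_consPath_of_notMem {A : ℕ → Set V} {p : V × ℝ≥0∞} (ω : Path V)
    (h : p.1 ∉ A 0) :
    ruleTime A (consPath p ω) = p.2 + ruleTime (fun j => A (j + 1)) ω := by
  unfold ruleTime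
  rw [← inf_iInf_nat_succ, ENNReal.add_iInf]
  simp only [consPath_zero, h, iInf_false, consPath_succ, jumpTime_succ_consPath, top_inf_eq]
  refine iInf_congr fun j => ?_
  by_cases hj : (ω j).1 ∈ A (j + 1) <;> simp [hj]

lemma ruleTime_le_iff {A : ℕ → Set V} {ω : Path V} {t : ℝ≥0} :
    ruleTime A ω ≤ t ↔ ∃ j, (ω j).1 ∈ A j ∧ jumpTime j ω ≤ t := by
  classical
  constructor
  · intro h
    by_cases hex : ∃ j, (ω j).1 ∈ A j
    · refine ⟨Nat.find hex, Nat.find_spec hex, le_trans ?_ h⟩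
      exact le_iInf₂ fun j hj => monotone_jumpTime ω (Nat.find_min' hex hj)
    · simp [ruleTime, not_exists.1 hex] at h
  · rintro ⟨j, hj, h⟩
    exact (iInf₂_le j hj).trans h

/-- The properties that almost every path has: the process really stays in each visited state, and
a jump leads to a different state. On such paths the process determines the path up to the first
infinite holding time. -/
def GoodPath (ω : Path V) : Prop :=
  ∀ k, 0 < (ω k).2 ∧ ((ω k).2 ≠ ∞ → (ω (k + 1)).1 ≠ (ω k).1)

lemma GoodPath.jumpTime_lt_succ {ω : Path V} (hω : GoodPath ω) {n : ℕ} (h : jumpTime n ω ≠ ∞) :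
    jumpTime n ω < jumpTime (n + 1) ω := by
  rw [jumpTime_succ]
  exact ENNReal.lt_add_right h (hω n).1.ne'

lemma GoodPath.process_eq {ω : Path V} (hω : GoodPath ω) {n : ℕ} {t : ℝ≥0}
    (h : jumpTime n ω = t) : process t ω = ((ω n).1 : OnePoint V) :=
  process_eq_of_mem h.le (h ▸ hω.jumpTime_lt_succ (by simp [h]))

lemma GoodPath.hitTime_eq {ω : Path V} (hω : GoodPath ω) (D : Set V) :
    hitTime D ω = ruleTime (fun _ => D) ω := by
  apply le_antisymm
  · refine le_iInf₂ fun j hj => ?_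
    by_cases h : jumpTime j ω = ∞
    · simp [h]
    · lift jumpTime j ω to ℝ≥0 using h with t ht
      exact iInf₂_le t ⟨_, hj, hω.process_eq ht.symm⟩
  · refine le_iInf₂ fun t ht => ?_
    obtain ⟨y, hy, hyt⟩ := ht
    rcases exists_mem_jumpInterval_or (t : ℝ≥0∞) ω with ⟨n, h1, h2⟩ | h
    · rw [process_eq_of_mem h1 h2] at hyt
      refine (iInf₂_le n ?_).trans h1
      rwa [OnePoint.coe_injective hyt]
    · rw [process_eq_infty h] at hyt
      exact absurd hyt (OnePoint.infty_ne_coe y)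

lemma min_jumpTime_ruleTime (D : Set V) (m : ℕ) (ω : Path V) :
    min (jumpTime m ω) (ruleTime (fun _ => D) ω) =
      ruleTime (fun j => {y | m ≤ j ∨ y ∈ D}) ω := by
  apply le_antisymm
  · refine le_iInf₂ fun j hj => ?_
    rcases hj with hj | hj
    · exact (min_le_left _ _).trans (monotone_jumpTime ω hj)
    · exact (min_le_right _ _).trans (iInf₂_le j hj)
  · refine le_min (iInf₂_le m (Or.inl le_rfl)) ?_
    exact le_iInf₂ fun j hj => iInf₂_le j (Or.inr hj)

end Paths

/-! ### Discounting at an exponential holding time -/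

lemma expMeasure_Ioi {l : ℝ} (hl : 0 < l) {c : ℝ} (hc : 0 ≤ c) :
    expMeasure l (Set.Ioi c) = ENNReal.ofReal (Real.exp (-l * c)) := by
  have := isProbabilityMeasure_expMeasure hl
  have h := cdf_expMeasure_eq hl c
  rw [if_pos hc, cdf_eq_real] at h
  rw [← Set.compl_Iic, ← ofReal_measureReal (measure_ne_top _ _),
    probReal_compl_eq_one_sub measurableSet_Iic, h]
  congr 1
  ring_nf

/-- Discounting an exponential density by `exp (-r t)` gives a multiple of an exponential density
of parameter `r + l`. -/
lemma setLIntegral_discount_expMeasure {r l : ℝ} (hr : 0 < r) (hl : 0 < l) {B : Set ℝ}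
    (hB : MeasurableSet B) :
    ∫⁻ t in B, discount r (ENNReal.ofReal t) ∂(expMeasure l) =
      ENNReal.ofReal (l / (r + l)) * expMeasure (r + l) B := by
  have hrl : 0 < r + l := by positivity
  have hm : ∀ a : ℝ, Measurable (exponentialPDF a) := fun a =>
    (measurable_exponentialPDFReal a).ennreal_ofReal
  have hE : ∀ a : ℝ, expMeasure a = volume.withDensity (exponentialPDF a) := fun _ => rfl
  rw [hE, hE, setLIntegral_withDensity_eq_setLIntegral_mul _ (hm l) (by fun_prop) hB,
    withDensity_apply _ hB, ← lintegral_const_mul _ (hm _)]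
  refine lintegral_congr fun t => ?_
  simp only [Pi.mul_apply]
  rcases lt_or_ge t 0 with ht | ht
  · simp [exponentialPDF_of_neg ht]
  · rw [exponentialPDF_of_nonneg ht, exponentialPDF_of_nonneg ht, discount,
      if_neg ENNReal.ofReal_ne_top, ENNReal.toReal_ofReal ht,
      ← ENNReal.ofReal_mul (by positivity), ← ENNReal.ofReal_mul (by positivity)]
    congr 1
    rw [mul_assoc, ← Real.exp_add, ← mul_assoc, div_mul_cancel₀ _ hrl.ne']
    ring_nf

lemma preimage_ofReal_Ioi (c : ℝ≥0) :
    ENNReal.ofReal ⁻¹' (Set.Ioi (c : ℝ≥0∞)) = Set.Ioi (c : ℝ) := by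
  ext t
  simp only [Set.mem_preimage, Set.mem_Ioi, ENNReal.ofReal]
  rw [ENNReal.coe_lt_coe, Real.lt_toNNReal_iff_coe_lt]

section Hold

variable {V : Type*} (L : MarkovGenerator V)

lemma holdLaw_of_eq_zero {x : V} (h : L.exitRate x = 0) : L.holdLaw x = Measure.dirac ∞ := by
  simp [holdLaw, h]

lemma holdLaw_of_pos {x : V} (h : 0 < L.exitRate x) :
    L.holdLaw x = (expMeasure (L.exitRate x)).map ENNReal.ofReal := by
  simp [holdLaw, h.ne']

lemma holdLaw_Ioi {x : V} (h : 0 < L.exitRate x) (c : ℝ≥0) :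
    L.holdLaw x (Set.Ioi (c : ℝ≥0∞)) = ENNReal.ofReal (Real.exp (-L.exitRate x * c)) := by
  rw [holdLaw_of_pos L h, Measure.map_apply ENNReal.measurable_ofReal measurableSet_Ioi]
  rw [preimage_ofReal_Ioi, expMeasure_Ioi h c.coe_nonneg]

lemma setLIntegral_discount_holdLaw_Ioi {r : ℝ} (hr : 0 < r) {x : V} (h : 0 < L.exitRate x)
    (c : ℝ≥0) :
    ∫⁻ s in Set.Ioi (c : ℝ≥0∞), discount r s ∂(L.holdLaw x) =
      ENNReal.ofReal (L.exitRate x / (r + L.exitRate x)) *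
        ENNReal.ofReal (Real.exp (-(r + L.exitRate x) * c)) := by
  rw [holdLaw_of_pos L h, setLIntegral_map measurableSet_Ioi (by fun_prop)
    ENNReal.measurable_ofReal]
  rw [preimage_ofReal_Ioi, setLIntegral_discount_expMeasure hr h measurableSet_Ioi,
    expMeasure_Ioi (by positivity) c.coe_nonneg]

lemma lintegral_discount_holdLaw {r : ℝ} (hr : 0 < r) (x : V) :
    ∫⁻ s, discount r s ∂(L.holdLaw x) =
      ENNReal.ofReal (L.exitRate x / (r + L.exitRate x)) := by
  rcases (L.exitRate_nonneg x).eq_or_lt with h | h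
  · rw [holdLaw_of_eq_zero L h.symm, lintegral_dirac]
    simp [← h]
  · have : IsProbabilityMeasure (expMeasure (r + L.exitRate x)) :=
      isProbabilityMeasure_expMeasure (by positivity)
    rw [holdLaw_of_pos L h, lintegral_map (by fun_prop) ENNReal.measurable_ofReal,
      ← setLIntegral_univ, setLIntegral_discount_expMeasure hr h MeasurableSet.univ]
    simp

lemma ae_holdLaw_pos (x : V) : ∀ᵐ s ∂(L.holdLaw x), 0 < s := by
  rcases (L.exitRate_nonneg x).eq_or_lt with h | h
  · rw [holdLaw_of_eq_zero L h.symm, ae_dirac_iff measurableSet_Ioi]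
    simp
  · have h1 := L.holdLaw_Ioi h 0
    simp only [NNReal.coe_zero, mul_zero, Real.exp_zero, ENNReal.ofReal_one,
      ENNReal.coe_zero] at h1
    exact (prob_compl_eq_zero_iff measurableSet_Ioi).2 h1

end Hold

/-! ### The first-jump operator -/

section FirstStepOperator

variable {V : Type*} (L : MarkovGenerator V)

/-- The expected discounted payoff at the first jump time,
`K[f](x) / (r + L(x)) = E_x[exp (-r σ_1) f(X_{σ_1})]`. -/
def firstJump (r : ℝ) (f : V → ℝ≥0∞) (x : V) : ℝ≥0∞ :=
  L.offDiag f x / ENNReal.ofReal (r + L.exitRate x)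

lemma ofReal_add_exitRate_ne_zero {r : ℝ} (hr : 0 < r) (x : V) :
    ENNReal.ofReal (r + L.exitRate x) ≠ 0 := by
  have := L.exitRate_nonneg x
  rw [Ne, ENNReal.ofReal_eq_zero]
  linarith

lemma firstJump_le_iff {r : ℝ} (hr : 0 < r) (f : V → ℝ≥0∞) (x : V) (a : ℝ≥0∞) :
    L.firstJump r f x ≤ a ↔ L.offDiag f x ≤ ENNReal.ofReal (r + L.exitRate x) * a := by
  rw [firstJump, ENNReal.div_le_iff (L.ofReal_add_exitRate_ne_zero hr x) ENNReal.ofReal_ne_top,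
    mul_comm]

lemma eq_firstJump_iff {r : ℝ} (hr : 0 < r) (f : V → ℝ≥0∞) (x : V) (a : ℝ≥0∞) :
    a = L.firstJump r f x ↔ ENNReal.ofReal (r + L.exitRate x) * a = L.offDiag f x := by
  rw [firstJump, ENNReal.eq_div_iff (L.ofReal_add_exitRate_ne_zero hr x) ENNReal.ofReal_ne_top]

lemma offDiag_mono {f g : V → ℝ≥0∞} (h : f ≤ g) : L.offDiag f ≤ L.offDiag g := fun x =>
  ENNReal.tsum_le_tsum fun y => by gcongr; exact h y

lemma firstJump_mono (r : ℝ) {f g : V → ℝ≥0∞} (h : f ≤ g) :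
    L.firstJump r f ≤ L.firstJump r g := fun x =>
  ENNReal.div_le_div_right (L.offDiag_mono h x) _

lemma offDiag_iSup {f : ℕ → V → ℝ≥0∞} (hf : Monotone f) (x : V) :
    L.offDiag (fun y => ⨆ n, f n y) x = ⨆ n, L.offDiag (f n) x := by
  simp only [offDiag, ENNReal.tsum_eq_iSup_sum, ENNReal.mul_iSup]
  rw [iSup_comm]
  refine iSup_congr fun s => ?_
  exact ENNReal.finsetSum_iSup_of_monotone fun y m n hmn => by gcongr; exact hf hmn y

lemma firstJump_iSup (r : ℝ) {f : ℕ → V → ℝ≥0∞} (hf : Monotone f) (x : V) :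
    L.firstJump r (fun y => ⨆ n, f n y) x = ⨆ n, L.firstJump r (f n) x := by
  simp only [firstJump, offDiag_iSup L hf, ENNReal.iSup_div]

lemma lintegral_jumpLaw_of_pos [MeasurableSpace V] [DiscreteMeasurableSpace V] {x : V}
    (h : 0 < L.exitRate x) (f : V → ℝ≥0∞) :
    ∫⁻ z, f z ∂(L.jumpLaw x) = L.offDiag f x / ENNReal.ofReal (L.exitRate x) := by
  rw [jumpLaw, if_neg h.ne', lintegral_sum_measure, offDiag, ENNReal.div_eq_inv_mul,
    ← ENNReal.tsum_mul_left]
  refine tsum_congr fun y => ?_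
  rw [lintegral_smul_measure, lintegral_dirac, ENNReal.ofReal_div_of_pos h,
    ENNReal.div_eq_inv_mul, smul_eq_mul, mul_assoc]

lemma offDiag_of_exitRate_eq_zero {x : V} (h : L.exitRate x = 0) (f : V → ℝ≥0∞) :
    L.offDiag f x = 0 := by
  have hs := L.hasSum_rate x
  rw [show -L.rate x x = 0 from h, hasSum_zero_iff_of_nonneg
    (fun y : {y : V // y ≠ x} => L.rate_nonneg x y y.2.symm)] at hs
  rw [offDiag, ENNReal.tsum_eq_zero]
  intro y
  have := congrFun hs y
  simp only [Pi.zero_apply] at this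
  simp [this]

lemma lintegral_discount_mul_lintegral_jumpLaw [MeasurableSpace V] [DiscreteMeasurableSpace V]
    {r : ℝ} (hr : 0 < r) (f : V → ℝ≥0∞) (x : V) :
    (∫⁻ s, discount r s ∂(L.holdLaw x)) * ∫⁻ z, f z ∂(L.jumpLaw x) = L.firstJump r f x := by
  rw [lintegral_discount_holdLaw L hr]
  rcases (L.exitRate_nonneg x).eq_or_lt with h | h
  · simp [← h, firstJump, offDiag_of_exitRate_eq_zero L h.symm]
  · rw [lintegral_jumpLaw_of_pos L h, firstJump, ENNReal.ofReal_div_of_pos (by positivity),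
      ENNReal.div_eq_inv_mul, mul_comm, ENNReal.div_eq_inv_mul, ENNReal.div_eq_inv_mul, mul_comm,
      mul_assoc, ← mul_assoc _ _ (L.offDiag f x), ENNReal.mul_inv_cancel _ ENNReal.ofReal_ne_top,
      one_mul]
    simpa using h

end FirstStepOperator

/-! ### Almost every path is good -/

section PathLaw

variable {V : Type*} [Countable V] [MeasurableSpace V] [DiscreteMeasurableSpace V]
  (L : MarkovGenerator V)

lemma ae_jumpLaw_ne {x : V} (h : 0 < L.exitRate x) : ∀ᵐ z ∂(L.jumpLaw x), z ≠ x := by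
  have := L.lintegral_jumpLaw_of_pos h (Set.indicator {x} 1)
  rw [lintegral_indicator_one (measurableSet_singleton x)] at this
  rw [ae_iff]
  simp only [not_not, Set.ofPred_eq_eq_singleton]
  rw [this, offDiag]
  simp only [ENNReal.div_eq_zero_iff, ENNReal.tsum_eq_zero]
  left
  rintro ⟨y, hy⟩
  simp [hy]

/-- A property holds almost surely if it holds almost surely after conditioning on the first
jump. -/
lemma ae_startAt_of_ae_consPath {x : V} {p : Path V → Prop} (hp : MeasurableSet {ω | p ω})
    (h : ∀ᵐ s ∂(L.holdLaw x), ∀ᵐ z ∂(L.jumpLaw x), ∀ᵐ ω ∂(L.startAt z), p (consPath (x, s) ω)) :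
    ∀ᵐ ω ∂(L.startAt x), p ω := by
  rw [ae_iff, ← Set.compl_ofPred, ← lintegral_indicator_one hp.compl,
    lintegral_startAt L x (measurable_one.indicator hp.compl)]
  refine lintegral_eq_zero_of_ae_eq_zero ?_
  filter_upwards [h] with s hs
  refine lintegral_eq_zero_of_ae_eq_zero ?_
  filter_upwards [hs] with z hz
  refine lintegral_eq_zero_of_ae_eq_zero ?_
  filter_upwards [hz] with ω hω
  simp [hω]

lemma ae_startAt_fst (x : V) : ∀ᵐ ω ∂(L.startAt x), (ω 0).1 = x := by
  refine L.ae_startAt_of_ae_consPath ?_ (by simp)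
  exact (by fun_prop : Measurable fun ω : Path V => (ω 0).1) (MeasurableSet.of_discrete (s := {x}))

lemma ae_goodPath (x : V) : ∀ᵐ ω ∂(L.startAt x), GoodPath ω := by
  simp only [GoodPath]
  rw [ae_all_iff]
  intro k
  have hm : ∀ k, MeasurableSet {ω : Path V | 0 < (ω k).2 ∧
      ((ω k).2 ≠ ∞ → (ω (k + 1)).1 ≠ (ω k).1)} := by
    intro k
    have h1 : MeasurableSet {q : V × V | q.1 ≠ q.2} := MeasurableSet.of_discrete
    have h2 : Measurable fun ω : Path V => ((ω (k + 1)).1, (ω k).1) := by fun_prop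
    have h3 : Measurable fun ω : Path V => (ω k).2 := by fun_prop
    exact (h3 measurableSet_Ioi).inter ((h3 (measurableSet_singleton ∞).compl).imp (h2 h1))
  induction k generalizing x with
  | zero =>
    refine L.ae_startAt_of_ae_consPath (hm 0) ?_
    rcases (L.exitRate_nonneg x).eq_or_lt with h | h
    · rw [holdLaw_of_eq_zero L h.symm, ae_dirac_eq]
      simp
    · filter_upwards [L.ae_holdLaw_pos x] with s hs
      filter_upwards [L.ae_jumpLaw_ne h] with z hz
      filter_upwards [L.ae_startAt_fst z] with ω hω
      simpa [hω, hs] using fun _ => hz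
  | succ k ih =>
    refine L.ae_startAt_of_ae_consPath (hm (k + 1)) ?_
    exact Eventually.of_forall fun s => Eventually.of_forall fun z => ih z

/-! ### Values of stopping rules on the visited states -/

/-- The value of a payoff stopped at a jump time, by conditioning on the first jump. -/
lemma stopValue_ruleTime {r : ℝ} (hr : 0 < r) (f : V → ℝ≥0∞) (A : ℕ → Set V) (x : V)
    [Decidable (x ∈ A 0)] :
    L.stopValue r f (ruleTime A) x = if x ∈ A 0 then f x else
      L.firstJump r (L.stopValue r f (ruleTime fun j => A (j + 1))) x := by
  have hm := fun A : ℕ → Set V => measurable_discountedPayoff r f (measurable_ruleTime A)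
  rw [stopValue, lintegral_startAt L x (hm A)]
  split_ifs with h
  · have : ∀ᵐ s ∂(L.holdLaw x), ∫⁻ z, ∫⁻ ω, discountedPayoff r f (ruleTime A (consPath (x, s) ω))
        (consPath (x, s) ω) ∂(L.startAt z) ∂(L.jumpLaw x) = f x := by
      filter_upwards [L.ae_holdLaw_pos x] with s hs
      have : ∀ ω : Path V, discountedPayoff r f (ruleTime A (consPath (x, s) ω))
          (consPath (x, s) ω) = f x := by
        intro ω
        rw [ruleTime_of_mem (by simpa using h), discountedPayoff_of_mem r f (n := 0) (by simp)
          (by rw [jumpTime_succ_consPath]; simpa using hs)]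
        simp
      simp [this]
    rw [lintegral_congr_ae this]
    simp
  · rw [← L.lintegral_discount_mul_lintegral_jumpLaw hr,
      ← lintegral_mul_const _ (measurable_discount r)]
    refine lintegral_congr fun s => ?_
    rw [← lintegral_const_mul _ (measurable_of_countable _)]
    refine lintegral_congr fun z => ?_
    rw [stopValue, ← lintegral_const_mul _ (hm _)]
    refine lintegral_congr fun ω => ?_
    rw [ruleTime_consPath_of_notMem ω (by simpa using h)]
    exact discountedPayoff_add_consPath r f (x, s) _ ω

/-- The truncated values `E_x[exp (-r (σ_m ∧ τ_D)) f(X_{σ_m ∧ τ_D})]` stop at jump times. -/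
lemma truncValue_eq (r : ℝ) (f : V → ℝ≥0∞) (D : Set V) (m : ℕ) (x : V) :
    L.truncValue r D f m x = L.stopValue r f (ruleTime fun j => {y | m ≤ j ∨ y ∈ D}) x := by
  refine lintegral_congr_ae ?_
  filter_upwards [L.ae_goodPath x] with ω hω
  rw [hω.hitTime_eq, min_jumpTime_ruleTime]

lemma truncValue_zero {r : ℝ} (hr : 0 < r) (f : V → ℝ≥0∞) (D : Set V) :
    L.truncValue r D f 0 = f := by
  classical
  funext x
  rw [truncValue_eq, stopValue_ruleTime L hr]
  simp

lemma truncValue_succ_of_mem {r : ℝ} (hr : 0 < r) (f : V → ℝ≥0∞) {D : Set V} (m : ℕ) {x : V}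
    (hx : x ∈ D) : L.truncValue r D f (m + 1) x = f x := by
  classical
  rw [truncValue_eq, stopValue_ruleTime L hr,
    if_pos (show x ∈ {y | m + 1 ≤ 0 ∨ y ∈ D} from Or.inr hx)]

lemma truncValue_succ_of_notMem {r : ℝ} (hr : 0 < r) (f : V → ℝ≥0∞) {D : Set V} (m : ℕ) {x : V}
    (hx : x ∉ D) :
    L.truncValue r D f (m + 1) x = L.firstJump r (L.truncValue r D f m) x := by
  classical
  rw [truncValue_eq, stopValue_ruleTime L hr, if_neg (by simpa using hx)]
  have : L.truncValue r D f m =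
      L.stopValue r f (ruleTime fun j => {y | m ≤ j ∨ y ∈ D}) :=
    funext fun y => L.truncValue_eq r f D m y
  simp only [this, Nat.add_le_add_iff_right]

end PathLaw

/-! ### Stopping rules on the embedded chain give stopping times -/

section StoppingRules

variable {V : Type*} [Countable V] [MeasurableSpace V] [DiscreteMeasurableSpace V]
  (L : MarkovGenerator V)

lemma completedFiltration_le_usualFiltration (x : V) (t : ℝ≥0) :
    L.completedFiltration x t ≤ L.usualFiltration x t :=
  (L.completedFiltration x).le_rightCont t

lemma measurableSet_process_eq {s t : ℝ≥0} (hst : s ≤ t) (x y : V) :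
    MeasurableSet[L.completedFiltration x t] {ω | process s ω = (y : OnePoint V)} := by
  refine ⟨_, ?_, EventuallyEq.rfl⟩
  have h : (⊤ : MeasurableSpace (OnePoint V)).comap (process (V := V) s) ≤ pastSigma V t :=
    le_iSup (fun j : Set.Iic t => (⊤ : MeasurableSpace (OnePoint V)).comap (process (V := V) j.1))
      ⟨s, hst⟩
  exact h _ ⟨{(y : OnePoint V)}, trivial, rfl⟩

/-- The completed σ-algebras do not distinguish sets that agree on good paths. -/
lemma measurableSet_completedFiltration_congr {x : V} {t : ℝ≥0} {A B : Set (Path V)}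
    (hB : MeasurableSet[L.completedFiltration x t] B)
    (h : ∀ ω, GoodPath ω → (ω ∈ A ↔ ω ∈ B)) :
    MeasurableSet[L.completedFiltration x t] A := by
  refine EventuallyMeasurableSet.congr (l := ae (L.startAt x)) hB ?_
  filter_upwards [L.ae_goodPath x] with ω hω
  exact propext (h ω hω)

/-- A countable set of times in `[0,t]` that contains `t` and meets every interval `[a,b)` with
`a ≤ t`. -/
lemma exists_countable_sampleTimes (t : ℝ≥0) : ∃ Q : Set ℝ≥0, Q.Countable ∧ (∀ q ∈ Q, q ≤ t) ∧
    ∀ a b : ℝ≥0∞, a ≤ t → a < b → ∃ q ∈ Q, a ≤ q ∧ (q : ℝ≥0∞) < b := by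
  obtain ⟨s, hs, hd⟩ := TopologicalSpace.exists_countable_dense ℝ≥0
  refine ⟨insert t s ∩ Set.Iic t, (hs.insert t).mono Set.inter_subset_left, fun q hq => hq.2, ?_⟩
  intro a b hat hab
  rcases hat.eq_or_lt with rfl | hat
  · exact ⟨t, ⟨Set.mem_insert _ _, Set.self_mem_Iic⟩, le_rfl, hab⟩
  · lift a to ℝ≥0 using hab.ne_top
    have hmin : min (t : ℝ≥0∞) b ≠ ∞ := ne_top_of_le_ne_top ENNReal.coe_ne_top (min_le_left _ _)
    have hlt : (a : ℝ≥0∞) < (min (t : ℝ≥0∞) b).toNNReal := by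
      rw [ENNReal.coe_toNNReal hmin]
      exact lt_min hat hab
    obtain ⟨q, hq, haq, hqb⟩ := hd.exists_between (ENNReal.coe_lt_coe.1 hlt)
    have hq' : (q : ℝ≥0∞) < min (t : ℝ≥0∞) b := by
      rw [← ENNReal.coe_toNNReal hmin]
      exact ENNReal.coe_lt_coe.2 hqb
    exact ⟨q, ⟨Set.mem_insert_of_mem _ hq, ENNReal.coe_le_coe.1 (hq'.le.trans (min_le_left _ _))⟩,
      (ENNReal.coe_lt_coe.2 haq).le, hq'.trans_le (min_le_right _ _)⟩

/-- If `σ_j` is a stopping time, the state reached at time `σ_j` is known at that time: it is the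
state observed at all sample times that follow `σ_j` closely enough. -/
lemma measurableSet_jumpTime_le_and_eq {x : V} {j : ℕ}
    (hj : ∀ t : ℝ≥0, MeasurableSet[L.completedFiltration x t] {ω | jumpTime j ω ≤ t})
    (t : ℝ≥0) (z : V) :
    MeasurableSet[L.completedFiltration x t] {ω | jumpTime j ω ≤ t ∧ (ω j).1 = z} := by
  obtain ⟨Q, hQ, hQt, hQs⟩ := exists_countable_sampleTimes t
  have hE : ∀ q ∈ Q, MeasurableSet[L.completedFiltration x t] {ω : Path V | jumpTime j ω ≤ q} :=
    fun q hq => (L.completedFiltration x).mono (hQt q hq) _ (hj q)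
  refine L.measurableSet_completedFiltration_congr
    (B := ⋃ q ∈ Q, {ω | jumpTime j ω ≤ q} ∩ ⋂ q' ∈ Q ∩ Set.Iic q,
      ({ω | jumpTime j ω ≤ q'}ᶜ ∪ {ω | process q' ω = (z : OnePoint V)})) ?_ ?_
  · refine MeasurableSet.biUnion hQ fun q hq => (hE q hq).inter ?_
    refine MeasurableSet.biInter (hQ.mono Set.inter_subset_left) fun q' hq' => ?_
    exact (hE q' hq'.1).compl.union (L.measurableSet_process_eq (hQt q' hq'.1) x z)
  · intro ω hω
    simp only [Set.mem_iUnion, Set.mem_inter_iff, Set.mem_iInter, Set.mem_union,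
      Set.mem_compl_iff, Set.mem_ofPred_eq, Set.mem_Iic, exists_prop]
    constructor
    · rintro ⟨h, rfl⟩
      have hlt := hω.jumpTime_lt_succ (ne_top_of_le_ne_top ENNReal.coe_ne_top h)
      obtain ⟨q, hq, hq1, hq2⟩ := hQs _ _ h hlt
      refine ⟨q, hq, hq1, fun q' hq' => ?_⟩
      by_cases h' : jumpTime j ω ≤ q'
      · exact Or.inr (process_eq_of_mem h' ((ENNReal.coe_le_coe.2 hq'.2).trans_lt hq2))
      · exact Or.inl h'
    · rintro ⟨q, hq, hq1, h⟩
      have ht : jumpTime j ω ≤ t := hq1.trans (ENNReal.coe_le_coe.2 (hQt q hq))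
      refine ⟨ht, ?_⟩
      have hlt := hω.jumpTime_lt_succ (ne_top_of_le_ne_top ENNReal.coe_ne_top ht)
      obtain ⟨q', hq', hq'q, h1, h2⟩ : ∃ q' ∈ Q, q' ≤ q ∧ jumpTime j ω ≤ q' ∧
          (q' : ℝ≥0∞) < jumpTime (j + 1) ω := by
        rcases hq1.eq_or_lt with he | hl
        · exact ⟨q, hq, le_rfl, hq1, he ▸ hlt⟩
        · obtain ⟨q', hq', h1, h2⟩ := hQs _ _ ht (lt_min hl hlt)
          exact ⟨q', hq', ENNReal.coe_le_coe.1 (h2.le.trans (min_le_left _ _)), h1,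
            h2.trans_le (min_le_right _ _)⟩
      have hz := (h q' ⟨hq', hq'q⟩).resolve_left (not_not.2 h1)
      rw [process_eq_of_mem h1 h2] at hz
      exact OnePoint.coe_injective hz

/-- The jump times are stopping times: a jump after `σ_j` is detected by a sample time at which the
process is not in the state reached at `σ_j`. -/
lemma measurableSet_jumpTime_le (x : V) (j : ℕ) (t : ℝ≥0) :
    MeasurableSet[L.completedFiltration x t] {ω | jumpTime j ω ≤ t} := by
  induction j generalizing t with
  | zero => simp
  | succ j ih =>
    obtain ⟨Q, hQ, hQt, hQs⟩ := exists_countable_sampleTimes t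
    refine L.measurableSet_completedFiltration_congr
      (B := ⋃ q ∈ Q, ⋃ y : V, {ω | jumpTime j ω ≤ q ∧ (ω j).1 = y} ∩
        {ω | process q ω = (y : OnePoint V)}ᶜ) ?_ ?_
    · refine MeasurableSet.biUnion hQ fun q hq => MeasurableSet.iUnion fun y => ?_
      refine MeasurableSet.inter ?_ (L.measurableSet_process_eq (hQt q hq) x y).compl
      exact (L.completedFiltration x).mono (hQt q hq) _
        (L.measurableSet_jumpTime_le_and_eq ih q y)
    · intro ω hω
      simp only [Set.mem_iUnion, Set.mem_inter_iff, Set.mem_compl_iff, Set.mem_ofPred_eq,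
        exists_prop]
      constructor
      · intro h
        have hfin : jumpTime (j + 1) ω ≠ ∞ := ne_top_of_le_ne_top ENNReal.coe_ne_top h
        obtain ⟨q, hq, hq1, hq2⟩ := hQs _ _ h (hω.jumpTime_lt_succ hfin)
        refine ⟨q, hq, _, ⟨(monotone_jumpTime ω j.le_succ).trans hq1, rfl⟩, ?_⟩
        rw [process_eq_of_mem hq1 hq2, OnePoint.coe_eq_coe]
        rw [jumpTime_succ, ENNReal.add_ne_top] at hfin
        exact (hω j).2 hfin.2
      · rintro ⟨q, hq, y, ⟨h1, rfl⟩, h2⟩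
        refine le_trans ?_ (ENNReal.coe_le_coe.2 (hQt q hq))
        by_contra hlt
        exact h2 (process_eq_of_mem h1 (not_le.1 hlt))

lemma ruleTime_mem_stoppingTimes (A : ℕ → Set V) (x : V) :
    ruleTime A ∈ L.stoppingTimes x := by
  intro t
  refine L.completedFiltration_le_usualFiltration x t _ ?_
  have : {ω : Path V | ruleTime A ω ≤ t} =
      ⋃ j : ℕ, ⋃ z : A j, {ω : Path V | jumpTime j ω ≤ t ∧ (ω j).1 = (z : V)} := by
    ext ω
    simp only [Set.mem_ofPred_eq, ruleTime_le_iff, Set.mem_iUnion]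
    constructor
    · rintro ⟨j, hj, h⟩
      exact ⟨j, ⟨_, hj⟩, h, rfl⟩
    · rintro ⟨j, z, h, hz⟩
      exact ⟨j, hz ▸ z.2, h⟩
  change MeasurableSet[L.completedFiltration x t] {ω : Path V | ruleTime A ω ≤ t}
  rw [this]
  exact MeasurableSet.iUnion fun j => MeasurableSet.iUnion fun z =>
    L.measurableSet_jumpTime_le_and_eq (L.measurableSet_jumpTime_le x j) t z

lemma stopValue_ruleTime_le_value (r : ℝ) (φ : V → ℝ≥0∞) (A : ℕ → Set V) (x : V) :
    L.stopValue r φ (ruleTime A) x ≤ L.value r φ x :=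
  le_iSup₂ (f := fun τ (_ : τ ∈ L.stoppingTimes x) => L.stopValue r φ τ x) _
    (L.ruleTime_mem_stoppingTimes A x)

end StoppingRules

/-! ### The recursion -/

section Recursion

variable {V : Type*} [Countable V] [MeasurableSpace V] [DiscreteMeasurableSpace V]
  (L : MarkovGenerator V)

lemma monotone_truncValue {r : ℝ} (hr : 0 < r) {D : Set V} {v : V → ℝ≥0∞}
    (h : ∀ x ∉ D, v x ≤ L.firstJump r v x) : Monotone (L.truncValue r D v) := by
  refine monotone_nat_of_le_succ fun m => ?_
  induction m with
  | zero =>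
    intro x
    by_cases hx : x ∈ D
    · rw [truncValue_zero L hr, truncValue_succ_of_mem L hr v 0 hx]
    · rw [truncValue_succ_of_notMem L hr v 0 hx, truncValue_zero L hr]
      exact h x hx
  | succ m ih =>
    intro x
    by_cases hx : x ∈ D
    · rw [truncValue_succ_of_mem L hr v _ hx, truncValue_succ_of_mem L hr v _ hx]
    · rw [truncValue_succ_of_notMem L hr v _ hx, truncValue_succ_of_notMem L hr v _ hx]
      exact L.firstJump_mono r ih x

lemma iSup_truncValue_of_mem {r : ℝ} (hr : 0 < r) {D : Set V} (v : V → ℝ≥0∞) {x : V}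
    (hx : x ∈ D) : ⨆ m, L.truncValue r D v m x = v x := by
  have : ∀ m, L.truncValue r D v m x = v x := by
    rintro (_ | m)
    · rw [truncValue_zero L hr]
    · exact truncValue_succ_of_mem L hr v m hx
  simp [this]

/-- Off `D` the limit of the truncated values solves `(r + L(x)) w(x) = K[w](x)`. -/
lemma iSup_truncValue_of_notMem {r : ℝ} (hr : 0 < r) {D : Set V} {v : V → ℝ≥0∞}
    (h : ∀ x ∉ D, v x ≤ L.firstJump r v x) {x : V} (hx : x ∉ D) :
    ⨆ m, L.truncValue r D v m x = L.firstJump r (fun y => ⨆ m, L.truncValue r D v m y) x := by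
  have hmono := L.monotone_truncValue hr h
  rw [firstJump_iSup L r hmono, ← Monotone.iSup_nat_add (fun m n hmn => hmono hmn x) 1]
  simp only [truncValue_succ_of_notMem L hr v _ hx]

/-- The truncated values of `v` are bounded by every excessive majorant of `v`. -/
lemma truncValue_le {r : ℝ} (hr : 0 < r) (D : Set V) {v w : V → ℝ≥0∞} (hvw : v ≤ w)
    (hw : L.firstJump r w ≤ w) (m : ℕ) : L.truncValue r D v m ≤ w := by
  induction m with
  | zero => rwa [truncValue_zero L hr]
  | succ m ih =>
    intro x
    by_cases hx : x ∈ D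
    · rw [truncValue_succ_of_mem L hr v _ hx]
      exact hvw x
    · rw [truncValue_succ_of_notMem L hr v _ hx]
      exact (L.firstJump_mono r ih x).trans (hw x)

variable (r : ℝ) (φ : V → ℝ≥0∞)

lemma mem_stopSet_succ_iff {r : ℝ} (hr : 0 < r) (n : ℕ) (x : V) :
    x ∈ L.stopSet r φ (n + 1) ↔
      x ∈ L.stopSet r φ n ∧ L.firstJump r (L.approx r φ n) x ≤ L.approx r φ n x := by
  rw [firstJump_le_iff L hr]
  rfl

lemma antitone_stopSet : Antitone (L.stopSet r φ) :=
  antitone_nat_of_succ_le fun _ _ hx => hx.1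

variable {r}

lemma approx_le_firstJump_of_notMem_succ (hr : 0 < r) {n : ℕ}
    (h : ∀ x ∉ L.stopSet r φ n, L.approx r φ n x = L.firstJump r (L.approx r φ n) x) :
    ∀ x ∉ L.stopSet r φ (n + 1), L.approx r φ n x ≤ L.firstJump r (L.approx r φ n) x := by
  intro x hx
  by_cases hxn : x ∈ L.stopSet r φ n
  · rw [mem_stopSet_succ_iff L φ hr, not_and] at hx
    exact (not_le.1 (hx hxn)).le
  · exact (h x hxn).le

/-- `u_n` is harmonic for the discounted process off `D_n`. -/
lemma approx_eq_firstJump (hr : 0 < r) (n : ℕ) :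
    ∀ x ∉ L.stopSet r φ n, L.approx r φ n x = L.firstJump r (L.approx r φ n) x := by
  induction n with
  | zero => exact fun x hx => absurd (Set.mem_univ x) hx
  | succ n ih =>
    intro x hx
    exact L.iSup_truncValue_of_notMem hr (L.approx_le_firstJump_of_notMem_succ φ hr ih) hx

lemma approx_eq_of_mem (hr : 0 < r) (n : ℕ) :
    ∀ x ∈ L.stopSet r φ n, L.approx r φ n x = φ x := by
  induction n with
  | zero => exact fun _ _ => rfl
  | succ n ih =>
    intro x hx
    exact (L.iSup_truncValue_of_mem hr _ hx).trans (ih x hx.1)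

lemma monotone_approxTrunc (hr : 0 < r) (n : ℕ) : Monotone (L.approxTrunc r φ n) :=
  L.monotone_truncValue hr
    (L.approx_le_firstJump_of_notMem_succ φ hr (L.approx_eq_firstJump φ hr n))

lemma monotone_approx (hr : 0 < r) : Monotone (L.approx r φ) := by
  refine monotone_nat_of_le_succ fun n x => ?_
  have : L.approxTrunc r φ n 0 x = L.approx r φ n x :=
    congrFun (L.truncValue_zero hr _ _) x
  rw [← this]
  exact le_iSup (fun m => L.approxTrunc r φ n m x) 0

lemma approx_le (hr : 0 < r) {w : V → ℝ≥0∞} (hφ : φ ≤ w) (hw : L.firstJump r w ≤ w) (n : ℕ) :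
    L.approx r φ n ≤ w := by
  induction n with
  | zero => exact hφ
  | succ n ih => exact fun x => iSup_le fun m => L.truncValue_le hr _ ih hw m x

/-- The limit of the `u_n` is excessive. -/
lemma firstJump_iSup_approx_le (hr : 0 < r) (x : V) :
    L.firstJump r (fun y => ⨆ n, L.approx r φ n y) x ≤ ⨆ n, L.approx r φ n x := by
  rw [firstJump_iSup L r (L.monotone_approx φ hr)]
  refine iSup_le fun n => ?_
  by_cases hx : x ∈ L.stopSet r φ (n + 1)
  · exact ((L.mem_stopSet_succ_iff φ hr n x).1 hx).2.trans
      (le_iSup (fun n => L.approx r φ n x) n)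
  · refine (L.firstJump_mono r (L.monotone_approx φ hr n.le_succ) x).trans ?_
    rw [← L.approx_eq_firstJump φ hr (n + 1) x hx]
    exact le_iSup (fun n => L.approx r φ n x) (n + 1)

end Recursion

/-! ### Optimal stopping with finitely many jumps -/

section FiniteHorizon

variable {V : Type*} (L : MarkovGenerator V) (r : ℝ) (φ : V → ℝ≥0∞)

/-- The value of the problem of stopping at one of the jump times `σ_0, …, σ_k`, given by backward
induction. -/
def horizonValue : ℕ → V → ℝ≥0∞
  | 0 => φ
  | k + 1 => φ ⊔ L.firstJump r (horizonValue k)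

lemma le_horizonValue (k : ℕ) : φ ≤ L.horizonValue r φ k := by
  cases k with
  | zero => exact le_rfl
  | succ k => exact le_sup_left

lemma monotone_horizonValue : Monotone (L.horizonValue r φ) := by
  refine monotone_nat_of_le_succ fun k => ?_
  induction k with
  | zero => exact L.le_horizonValue r φ 1
  | succ k ih => exact sup_le_sup_left (L.firstJump_mono r ih) φ

lemma firstJump_iSup_horizonValue_le :
    L.firstJump r (fun y => ⨆ k, L.horizonValue r φ k y) ≤
      fun y => ⨆ k, L.horizonValue r φ k y := by
  intro x
  rw [firstJump_iSup L r (L.monotone_horizonValue r φ)]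
  exact iSup_le fun k => le_trans le_sup_right (le_iSup (fun k => L.horizonValue r φ k x) (k + 1))

variable [Countable V] [MeasurableSpace V] [DiscreteMeasurableSpace V] {r}

/-- With `k` jumps left it is optimal to stop as soon as the payoff equals the value for the
remaining number of jumps. -/
lemma horizonValue_eq_stopValue (hr : 0 < r) (k : ℕ) (x : V) :
    L.horizonValue r φ k x = L.stopValue r φ
      (ruleTime fun j => {y | k ≤ j ∨ L.horizonValue r φ (k - j) y = φ y}) x := by
  classical
  induction k generalizing x with
  | zero =>
    rw [stopValue_ruleTime L hr, if_pos (by exact Or.inl le_rfl)]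
    rfl
  | succ k ih =>
    rw [stopValue_ruleTime L hr]
    split_ifs with h
    · simpa using h
    · have hne : L.horizonValue r φ (k + 1) x ≠ φ x := by simpa using h
      have hmax : L.horizonValue r φ (k + 1) x =
          max (φ x) (L.firstJump r (L.horizonValue r φ k) x) := rfl
      rw [hmax] at hne ⊢
      rw [max_eq_right (le_of_not_ge fun hle => hne (max_eq_left hle)), funext ih]
      simp only [Nat.add_le_add_iff_right, Nat.add_sub_add_right]

lemma approx_le_value (hr : 0 < r) (n : ℕ) : L.approx r φ n ≤ L.value r φ := by
  refine le_trans (L.approx_le φ hr (fun x => le_iSup (fun k => L.horizonValue r φ k x) 0)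
    (L.firstJump_iSup_horizonValue_le r φ) n) fun x => iSup_le fun k => ?_
  rw [horizonValue_eq_stopValue L φ hr]
  exact L.stopValue_ruleTime_le_value r φ _ x

end FiniteHorizon

/-! ### Stopping times of the process between two jumps -/

section Nonanticipating

variable {V : Type*}

/-- The path that follows `ω` up to its `n`-th state and then stays there forever. -/
def stall (n : ℕ) (ω : Path V) : Path V := fun k => if k < n then ω k else ((ω n).1, ∞)

lemma stall_zero_consPath (x : V) (s : ℝ≥0∞) (ω : Path V) :
    stall 0 (consPath (x, s) ω) = fun _ => (x, ∞) := by
  funext k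
  simp [stall]

lemma stall_succ_consPath (n : ℕ) (p : V × ℝ≥0∞) (ω : Path V) :
    stall (n + 1) (consPath p ω) = consPath p (stall n ω) := by
  funext k
  cases k <;> simp [stall]

lemma jumpTime_stall {n k : ℕ} (hk : k ≤ n) (ω : Path V) :
    jumpTime k (stall n ω) = jumpTime k ω := by
  refine Finset.sum_congr rfl fun i hi => ?_
  have := Finset.mem_range.1 hi
  simp [stall, show i < n by omega]

lemma jumpTime_succ_le_stall {n k : ℕ} (hk : k ≤ n) (ω : Path V) :
    jumpTime (k + 1) ω ≤ jumpTime (k + 1) (stall n ω) := by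
  rcases hk.eq_or_lt with rfl | hk
  · simp [jumpTime_succ, stall]
  · rw [jumpTime_stall hk]

/-- Until the jump time `σ_{n+1}`, the process cannot tell a path from the one that stays in its
`n`-th state forever. -/
lemma process_stall {n : ℕ} {t : ℝ≥0} {ω : Path V} (ht : (t : ℝ≥0∞) < jumpTime (n + 1) ω) :
    process t (stall n ω) = process t ω := by
  rcases exists_mem_jumpInterval_or (t : ℝ≥0∞) ω with ⟨k, h1, h2⟩ | h
  · have hkn : k ≤ n := by
      by_contra hlt
      exact absurd (ht.trans_le (monotone_jumpTime ω (not_le.1 hlt))) (not_lt.2 h1)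
    rw [process_eq_of_mem h1 h2, process_eq_of_mem (n := k) (by rwa [jumpTime_stall hkn])
      (h2.trans_le (jumpTime_succ_le_stall hkn ω))]
    rcases hkn.eq_or_lt with rfl | hk
    · simp [stall]
    · simp [stall, hk]
  · exact absurd (h (n + 1)) (not_le.2 ht)

/-- A time `ρ` such that, until the jump time `σ_{n+1}`, the decision to stop depends only on the
states `Z_0, …, Z_n` and the jump times `σ_1, …, σ_n`. -/
def Nonanticipating (ρ : Path V → ℝ≥0∞) : Prop :=
  ∀ n ω, min (ρ ω) (jumpTime (n + 1) ω) = min (ρ (stall n ω)) (jumpTime (n + 1) ω)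

/-- What remains of a nonanticipating time after the first jump is again nonanticipating. -/
lemma Nonanticipating.sub_consPath {ρ : Path V → ℝ≥0∞} (hρ : Nonanticipating ρ) (x : V)
    {s : ℝ≥0∞} (hs : s ≠ ∞) : Nonanticipating fun ω => ρ (consPath (x, s) ω) - s := by
  intro n ω
  have h := hρ (n + 1) (consPath (x, s) ω)
  rw [stall_succ_consPath, jumpTime_succ_consPath] at h
  have h' := congrArg (fun a => a - s) h
  have hm : Monotone fun a : ℝ≥0∞ => a - s := fun a b hab => tsub_le_tsub_right hab s
  simpa only [hm.map_min, ENNReal.add_sub_cancel_left hs] using h'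

/-- A nonanticipating time that occurs before the first jump is deterministic. -/
lemma Nonanticipating.min_consPath {ρ : Path V → ℝ≥0∞} (hρ : Nonanticipating ρ) (x : V)
    (s : ℝ≥0∞) (ω : Path V) :
    min (ρ (consPath (x, s) ω)) s = min (ρ fun _ => (x, ∞)) s := by
  have h := hρ 0 (consPath (x, s) ω)
  rwa [stall_zero_consPath, jumpTime_succ_consPath, jumpTime_zero, add_zero] at h

/-- Events observed up to time `t` depend only on the process up to time `t`. -/
lemma mem_iff_of_measurableSet_pastSigma {t : ℝ≥0} {A : Set (Path V)}
    (hA : MeasurableSet[pastSigma V t] A) {ω ω' : Path V}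
    (h : ∀ s ≤ t, process s ω = process s ω') : ω ∈ A ↔ ω' ∈ A := by
  let m : MeasurableSpace (Path V) :=
    { MeasurableSet' := fun B => ω ∈ B ↔ ω' ∈ B
      measurableSet_empty := by simp
      measurableSet_compl := fun B hB => by simp [hB]
      measurableSet_iUnion := fun B hB => by simp [hB] }
  have hle : pastSigma V t ≤ m := by
    refine iSup_le fun s => ?_
    rintro _ ⟨B, -, rfl⟩
    change process s.1 ω ∈ B ↔ process s.1 ω' ∈ B
    rw [h s.1 s.2]
  exact hle A hA

variable [Countable V] [MeasurableSpace V] [DiscreteMeasurableSpace V] (L : MarkovGenerator V)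

lemma measurableSet_lt_of_mem_stoppingTimes {x : V} {τ : Path V → ℝ≥0∞}
    (hτ : τ ∈ L.stoppingTimes x) (q : ℝ≥0) :
    MeasurableSet[L.completedFiltration x q] {ω | τ ω < q} := by
  obtain ⟨s, hs, hd⟩ := TopologicalSpace.exists_countable_dense ℝ≥0
  have : {ω | τ ω < q} = ⋃ p ∈ s ∩ Set.Iio q, {ω | τ ω ≤ (p : ℝ≥0)} := by
    ext ω
    simp only [Set.mem_ofPred_eq, Set.mem_iUnion, exists_prop]
    constructor
    · intro h
      lift τ ω to ℝ≥0 using h.ne_top with a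
      obtain ⟨p, hp, h1, h2⟩ := hd.exists_between (ENNReal.coe_lt_coe.1 h)
      exact ⟨p, ⟨hp, h2⟩, ENNReal.coe_le_coe.2 h1.le⟩
    · rintro ⟨p, ⟨-, hp⟩, h⟩
      exact h.trans_lt (ENNReal.coe_lt_coe.2 hp)
  rw [this]
  refine MeasurableSet.biUnion (hs.mono Set.inter_subset_left) fun p hp => ?_
  have h1 : L.usualFiltration x p ≤ L.completedFiltration x q := by
    rw [usualFiltration, Filtration.rightCont_eq]
    exact iInf₂_le q hp.2
  exact h1 _ (hτ p)

/-- Every stopping time of the completed right-continuous filtration is almost surely equal to a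
measurable nonanticipating time. -/
lemma exists_nonanticipating_ae_eq {x : V} {τ : Path V → ℝ≥0∞} (hτ : τ ∈ L.stoppingTimes x) :
    ∃ ρ : Path V → ℝ≥0∞, Measurable ρ ∧ Nonanticipating ρ ∧ τ =ᵐ[L.startAt x] ρ := by
  classical
  choose A hA hAτ using fun q : ℝ≥0 => L.measurableSet_lt_of_mem_stoppingTimes hτ q
  obtain ⟨s, hs, hd⟩ := TopologicalSpace.exists_countable_dense ℝ≥0
  have := hs.to_subtype
  refine ⟨fun ω => ⨅ (q : s) (_ : ω ∈ A q), ((q : ℝ≥0) : ℝ≥0∞), ?_, ?_, ?_⟩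
  · refine Measurable.iInf fun q => ?_
    have hle : pastSigma V (q : ℝ≥0) ≤ MeasurableSpace.pi :=
      iSup_le fun i => (measurable_process (V := V) i.1).comap_le
    have : (fun ω => ⨅ (_ : ω ∈ A q), ((q : ℝ≥0) : ℝ≥0∞)) =
        fun ω => if ω ∈ A q then ((q : ℝ≥0) : ℝ≥0∞) else ∞ := by
      funext ω
      by_cases h : ω ∈ A q <;> simp [h]
    rw [this]
    exact Measurable.ite (hle _ (hA q)) measurable_const measurable_const
  · intro n ω
    have key : ∀ q : ℝ≥0, (q : ℝ≥0∞) < jumpTime (n + 1) ω → (stall n ω ∈ A q ↔ ω ∈ A q) :=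
      fun q hq => mem_iff_of_measurableSet_pastSigma (hA q) fun t ht =>
        process_stall ((ENNReal.coe_le_coe.2 ht).trans_lt hq)
    apply le_antisymm
    · refine le_min (le_iInf₂ fun q hq => ?_) (min_le_right _ _)
      by_cases hlt : ((q : ℝ≥0) : ℝ≥0∞) < jumpTime (n + 1) ω
      · exact (min_le_left _ _).trans (iInf₂_le q ((key q hlt).1 hq))
      · exact (min_le_right _ _).trans (not_lt.1 hlt)
    · refine le_min (le_iInf₂ fun q hq => ?_) (min_le_right _ _)
      by_cases hlt : ((q : ℝ≥0) : ℝ≥0∞) < jumpTime (n + 1) ω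
      · exact (min_le_left _ _).trans (iInf₂_le q ((key q hlt).2 hq))
      · exact (min_le_right _ _).trans (not_lt.1 hlt)
  · have hall : ∀ᵐ ω ∂(L.startAt x), ∀ q : s, (τ ω < (q : ℝ≥0) ↔ ω ∈ A q) := by
      rw [ae_all_iff]
      intro q
      filter_upwards [hAτ q] with ω hω
      exact iff_of_eq hω
    filter_upwards [hall] with ω hω
    apply le_antisymm
    · exact le_iInf₂ fun q hq => ((hω q).2 hq).le
    · refine le_of_forall_gt fun c hc => ?_
      lift τ ω to ℝ≥0 using hc.ne_top with a ha
      obtain ⟨b, hab, hbc⟩ := ENNReal.lt_iff_exists_nnreal_btwn.1 hc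
      obtain ⟨q, hq, h1, h2⟩ := hd.exists_between (ENNReal.coe_lt_coe.1 hab)
      exact (iInf₂_le (⟨q, hq⟩ : s) ((hω ⟨q, hq⟩).1 (ENNReal.coe_lt_coe.2 h1))).trans_lt
        ((ENNReal.coe_lt_coe.2 h2).trans hbc)

end Nonanticipating

/-! ### Excessive functions dominate the value function -/

section UpperBound

variable {V : Type*}

lemma discount_le_one {r : ℝ} (hr : 0 ≤ r) (t : ℝ≥0∞) : discount r t ≤ 1 := by
  unfold discount
  split_ifs
  · exact zero_le_one
  · rw [ENNReal.ofReal_le_one, Real.exp_le_one_iff]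
    have := mul_nonneg hr t.toReal_nonneg
    linarith

lemma intervalPayoff_succ_consPath (r : ℝ) (f : V → ℝ≥0∞) (n : ℕ) (x : V) {s T : ℝ≥0∞}
    (h : s ≤ T) (ω : Path V) :
    intervalPayoff r f (n + 1) T (consPath (x, s) ω) =
      discount r s * intervalPayoff r f n (T - s) ω := by
  by_cases hs : s = ∞
  · subst hs
    obtain rfl := top_le_iff.1 h
    rw [intervalPayoff_of_le r f le_top, discount_top, zero_mul]
  obtain ⟨T, rfl⟩ := exists_add_of_le h
  rw [ENNReal.add_sub_cancel_left hs]
  simp only [intervalPayoff, jumpTime_succ_consPath, ENNReal.add_le_add_iff_left hs,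
    ENNReal.add_lt_add_iff_left hs, consPath_succ, discount_add]
  split_ifs
  · rw [mul_assoc]
  · simp

variable (L : MarkovGenerator V)

/-- Waiting at `x` until the deterministic time `c` or the first jump, whichever comes first, does
not improve an excessive value: the discounted value is
`e^{-(r+l)c} w(x) + (1 - e^{-(r+l)c}) K[w](x) / (r + l)` with `l = L(x)`. -/
lemma lintegral_wait_le [MeasurableSpace V] [DiscreteMeasurableSpace V] {r : ℝ} (hr : 0 < r)
    {w : V → ℝ≥0∞} {x : V} (hw : L.firstJump r w x ≤ w x) (c : ℝ≥0∞) :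
    ∫⁻ s, ((Set.Ioi c).indicator (fun _ => discount r c * w x) s +
      (Set.Iic c).indicator (fun s => discount r s * ∫⁻ z, w z ∂(L.jumpLaw x)) s)
        ∂(L.holdLaw x) ≤ w x := by
  rw [lintegral_add_left (measurable_const.indicator measurableSet_Ioi),
    lintegral_indicator_const measurableSet_Ioi, lintegral_indicator measurableSet_Iic,
    lintegral_mul_const _ (measurable_discount r)]
  rcases (L.exitRate_nonneg x).eq_or_lt with h | h
  · have hle : ∫⁻ s in Set.Iic c, discount r s ∂(L.holdLaw x) ≤ 0 := by
      refine (setLIntegral_le_lintegral _ _).trans ?_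
      rw [holdLaw_of_eq_zero L h.symm, lintegral_dirac, discount_top]
    rw [le_antisymm hle bot_le, zero_mul, add_zero]
    calc discount r c * w x * L.holdLaw x (Set.Ioi c) ≤ 1 * w x * 1 := by
          gcongr
          · exact discount_le_one hr.le c
          · exact prob_le_one
      _ = w x := by simp
  have hjump := L.lintegral_discount_mul_lintegral_jumpLaw hr w x
  rw [lintegral_discount_holdLaw L hr] at hjump
  induction c using ENNReal.recTopCoe with
  | top =>
    rw [discount_top, zero_mul, zero_mul, zero_add, Set.Iic_top, setLIntegral_univ,
      lintegral_discount_holdLaw L hr, hjump]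
    exact hw
  | coe c =>
    set q := ENNReal.ofReal (L.exitRate x / (r + L.exitRate x)) with hq
    set E := ENNReal.ofReal (Real.exp (-(r + L.exitRate x) * c)) with hE
    have hE1 : E ≤ 1 := by
      rw [hE, ENNReal.ofReal_le_one, Real.exp_le_one_iff]
      have := mul_nonneg (add_pos hr h).le c.coe_nonneg
      linarith
    have hsum : ∫⁻ s in Set.Iic (c : ℝ≥0∞), discount r s ∂(L.holdLaw x) + q * E = q := by
      rw [hq, hE, ← setLIntegral_discount_holdLaw_Ioi L hr h c, ← Set.compl_Iic,
        lintegral_add_compl _ measurableSet_Iic, lintegral_discount_holdLaw L hr]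
    have hJ : ∫⁻ s in Set.Iic (c : ℝ≥0∞), discount r s ∂(L.holdLaw x) = (1 - E) * q := by
      rw [ENNReal.sub_mul fun _ _ => ENNReal.ofReal_ne_top, one_mul, mul_comm E]
      exact ENNReal.eq_sub_of_add_eq
        (ENNReal.mul_ne_top ENNReal.ofReal_ne_top ENNReal.ofReal_ne_top) hsum
    have hEw : discount r c * L.holdLaw x (Set.Ioi (c : ℝ≥0∞)) = E := by
      rw [holdLaw_Ioi L h, discount, if_neg ENNReal.coe_ne_top,
        ← ENNReal.ofReal_mul (Real.exp_pos _).le, ← Real.exp_add, hE, ENNReal.coe_toReal]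
      congr 2
      ring
    rw [hJ, mul_right_comm, hEw, mul_assoc, hjump]
    calc E * w x + (1 - E) * L.firstJump r w x ≤ E * w x + (1 - E) * w x := by gcongr
      _ = w x := by rw [← add_mul, add_tsub_cancel_of_le hE1, one_mul]

variable [Countable V] [MeasurableSpace V] [DiscreteMeasurableSpace V]

/-- An excessive function dominates the expected payoffs of nonanticipating times, collected
before the `m`-th jump; the induction on `m` removes the first jump. -/
lemma lintegral_sum_intervalPayoff_le {r : ℝ} (hr : 0 < r) {w : V → ℝ≥0∞}
    (hw : L.firstJump r w ≤ w) (m : ℕ) (x : V) {ρ : Path V → ℝ≥0∞} (hm : Measurable ρ)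
    (hρ : Nonanticipating ρ) :
    ∫⁻ ω, ∑ n ∈ Finset.range m, intervalPayoff r w n (ρ ω) ω ∂(L.startAt x) ≤ w x := by
  induction m generalizing x ρ with
  | zero => simp
  | succ m ih =>
    rw [lintegral_startAt L x
      (Finset.measurable_fun_sum _ fun n _ => measurable_intervalPayoff r w n hm)]
    refine le_trans (lintegral_mono fun s => ?_) (L.lintegral_wait_le hr (hw x) (ρ fun _ => (x, ∞)))
    set c := ρ fun _ => (x, ∞) with hc
    rcases lt_or_ge c s with hcs | hcs
    · -- stopping occurs at the deterministic time `c`, before the first jump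
      have hval : ∀ ω : Path V, ∑ n ∈ Finset.range (m + 1),
          intervalPayoff r w n (ρ (consPath (x, s) ω)) (consPath (x, s) ω) =
            discount r c * w x := by
        intro ω
        have hmin := hρ.min_consPath x s ω
        rw [← hc, min_eq_left hcs.le] at hmin
        have hρc : ρ (consPath (x, s) ω) = c := by
          rcases min_choice (ρ (consPath (x, s) ω)) s with h | h
          · rw [← h, hmin]
          · exact absurd (h ▸ hmin) hcs.ne'
        rw [hρc, Finset.sum_range_succ', intervalPayoff_of_mem r w (by simp)
          (by rw [jumpTime_succ_consPath]; simpa using hcs)]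
        rw [Finset.sum_eq_zero, zero_add, consPath_zero]
        intro n _
        refine intervalPayoff_of_lt r w (hcs.trans_le ?_)
        rw [jumpTime_succ_consPath]
        exact le_self_add
      simp [hval, hcs, not_le.2 hcs]
    · -- the first jump occurs before the decision to stop
      have hval : ∀ ω : Path V, ∑ n ∈ Finset.range (m + 1),
          intervalPayoff r w n (ρ (consPath (x, s) ω)) (consPath (x, s) ω) =
            discount r s * ∑ n ∈ Finset.range m,
              intervalPayoff r w n (ρ (consPath (x, s) ω) - s) ω := by
        intro ω
        have hmin := hρ.min_consPath x s ω
        rw [← hc, min_eq_right hcs, min_eq_right_iff] at hmin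
        rw [Finset.sum_range_succ', intervalPayoff_of_le r w (n := 0), add_zero, Finset.mul_sum]
        · exact Finset.sum_congr rfl fun n _ => intervalPayoff_succ_consPath r w n x hmin ω
        · rw [jumpTime_succ_consPath]
          simpa using hmin
      simp only [hval, Set.indicator_of_notMem (Set.notMem_Ioi.2 hcs),
        Set.indicator_of_mem (Set.mem_Iic.2 hcs), zero_add]
      by_cases hs : s = ∞
      · simp [hs]
      have hm' : Measurable fun ω : Path V => ρ (consPath (x, s) ω) - s :=
        (hm.comp (by fun_prop : Measurable fun ω : Path V => consPath (x, s) ω)).sub_const s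
      rw [← lintegral_const_mul _ (measurable_of_countable w)]
      refine lintegral_mono fun z => ?_
      rw [lintegral_const_mul _
        (Finset.measurable_fun_sum _ fun n _ => measurable_intervalPayoff r w n hm')]
      gcongr
      exact ih z hm' (hρ.sub_consPath x hs)

/-- Every excessive majorant of the payoff dominates the value function. -/
theorem value_le {r : ℝ} (hr : 0 < r) {φ w : V → ℝ≥0∞} (hφ : φ ≤ w)
    (hw : L.firstJump r w ≤ w) : L.value r φ ≤ w := by
  intro x
  refine iSup₂_le fun τ hτ => ?_
  obtain ⟨ρ, hm, hρ, hτρ⟩ := L.exists_nonanticipating_ae_eq hτ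
  have hae : ∀ᵐ ω ∂(L.startAt x), discountedPayoff r φ (τ ω) ω =
      ∑' n, intervalPayoff r φ n (ρ ω) ω := by
    filter_upwards [hτρ] with ω hω
    rw [hω, discountedPayoff_eq_tsum]
  rw [stopValue, lintegral_congr_ae hae,
    lintegral_tsum fun n => (measurable_intervalPayoff r φ n hm).aemeasurable]
  refine ENNReal.tsum_le_of_sum_range_le fun m => ?_
  rw [← lintegral_finsetSum _ fun n _ => measurable_intervalPayoff r φ n hm]
  refine le_trans (lintegral_mono fun ω => ?_) (L.lintegral_sum_intervalPayoff_le hr hw m x hm hρ)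
  exact Finset.sum_le_sum fun n _ => intervalPayoff_mono r hφ n _ ω

end UpperBound

/-! ### The limit of the recursion -/

section Limit

variable {V : Type*} [Countable V] [MeasurableSpace V] [DiscreteMeasurableSpace V]
  (L : MarkovGenerator V)

theorem iSup_approx_eq_value {r : ℝ} (hr : 0 < r) (φ : V → ℝ≥0∞) (x : V) :
    ⨆ n, L.approx r φ n x = L.value r φ x :=
  le_antisymm (iSup_le fun n => L.approx_le_value φ hr n x)
    (L.value_le hr (fun y => le_iSup (fun n => L.approx r φ n y) 0)
      (L.firstJump_iSup_approx_le φ hr) x)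

theorem iInter_stopSet_eq {r : ℝ} (hr : 0 < r) (φ : V → ℝ≥0∞) :
    ⋂ n, L.stopSet r φ n = {x | L.value r φ x = φ x} := by
  ext x
  rw [Set.mem_iInter, Set.mem_ofPred_eq, ← L.iSup_approx_eq_value hr]
  constructor
  · intro h
    simp [fun n => L.approx_eq_of_mem φ hr n x (h n)]
  · intro h n
    induction n with
    | zero => exact Set.mem_univ x
    | succ n ih =>
      -- `u_n(x) = φ(x) = u(x)`, and `u` is excessive and dominates `u_n`
      refine (L.mem_stopSet_succ_iff φ hr n x).2 ⟨ih, ?_⟩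
      rw [L.approx_eq_of_mem φ hr n x ih, ← h]
      refine le_trans (L.firstJump_mono r (fun y => ?_) x) (L.firstJump_iSup_approx_le φ hr x)
      exact le_iSup (fun n => L.approx r φ n y) n

end Limit

end MarkovGenerator

end

theorem mainTheorem1 {V : Type*} [Countable V] [MeasurableSpace V] [DiscreteMeasurableSpace V]
    (L : MarkovGenerator V) (φ : V → ℝ≥0∞) (r : ℝ) (hr : 0 < r) :
    -- the sets `D_n` are nonincreasing
    Antitone (L.stopSet r φ) ∧
    -- the functions `u_{n+1}^{(m)}` are nondecreasing in `m`, with limit `u_{n+1}`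
    (∀ n, Monotone (L.approxTrunc r φ n)) ∧
    (∀ n x, Tendsto (fun m => L.approxTrunc r φ n m x) atTop (𝓝 (L.approx r φ (n + 1) x))) ∧
    -- `u_n = φ` on `D_n`, and `(r + L(x)) u_n(x) = K[u_n](x)` off `D_n`
    (∀ n, ∀ x ∈ L.stopSet r φ n, L.approx r φ n x = φ x) ∧
    (∀ n, ∀ x ∉ L.stopSet r φ n,
      ENNReal.ofReal (r + L.exitRate x) * L.approx r φ n x = L.offDiag (L.approx r φ n) x) ∧
    -- the functions `u_n` are nondecreasing, and their limit is the value function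
    Monotone (L.approx r φ) ∧
    (∀ x, Tendsto (fun n => L.approx r φ n x) atTop (𝓝 (L.value r φ x))) ∧
    -- the intersection of the sets `D_n` is the stopping region
    ⋂ n, L.stopSet r φ n = {x | L.value r φ x = φ x} := by
  refine ⟨L.antitone_stopSet r φ, L.monotone_approxTrunc φ hr, fun n x => ?_,
    L.approx_eq_of_mem φ hr, fun n x hx => ?_, L.monotone_approx φ hr, fun x => ?_,
    L.iInter_stopSet_eq hr φ⟩
  · exact tendsto_atTop_iSup fun m k hmk => L.monotone_approxTrunc φ hr n hmk x
  · exact (L.eq_firstJump_iff hr _ x _).1 (L.approx_eq_firstJump φ hr n x hx)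
  · rw [← L.iSup_approx_eq_value hr]
    exact tendsto_atTop_iSup fun n k hnk => L.monotone_approx φ hr hnk x
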